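/- **$S$-brane solution governed by the $E_{10}$ Toda chain.** *The model.* Let $\vec\lambda_4,\dots,\vec\lambda_9\in\mathbb R^5$, $\vec\lambda_a=(\lambda_{a\alpha})$, satisfy $$\vec\lambda_a\cdot\vec\lambda_b=\min(a,b)-3-\frac{(a-1)(b-1)}{14}\quad(a,b=4,\dots,9),\qquad \vec\lambda_9=-2\vec\lambda_4 .$$ The $B_{16}$-model is the theory of a metric $g$ of signature $(-,+,\dots,+)$ in dimension $D=16$, five scalar fields $\varphi^1,\dots,\varphi^5$ and forms $F^4,\dots,F^9$ (with $\operatorname{rank}F^a=a$) with action $$S=\int d^{16}z\sqrt{|g|}\Big\{R[g]+g^{MN}\partial_M\vec\varphi\cdot\partial_N\vec\varphi-\sum_{a=4}^{9}\frac1{a!}e^{2\vec\lambda_a\cdot\vec\varphi}(F^a)^2_g\Big\}.$$ Its field equations, together with the Bianchi identities, are $$R_{MN}-\tfrac12 g_{MN}R=-\Big(\partial_M\vec\varphi\cdot\partial_N\vec\varphi-\tfrac12 g_{MN}\,g^{PQ}\partial_P\vec\varphi\cdot\partial_Q\vec\varphi\Big)+\sum_{a=4}^9\frac{e^{2\vec\lambda_a\cdot\vec\varphi}}{a!}\Big(a\,F^a_{MM_2\dots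 M_a}F^a_N{}^{M_2\dots M_a}-\tfrac12 g_{MN}(F^a)^2_g\Big),$$ $$\triangle[g]\varphi^\alpha+\sum_{a=4}^9\frac{\lambda_{a\alpha}}{a!}e^{2\vec\lambda_a\cdot\vec\varphi}(F^a)_g^2=0,\qquad \partial_{M_1}\big(\sqrt{|g|}\,e^{2\vec\lambda_a\cdot\vec\varphi}F^{a,M_1\dots M_a}\big)=0,\qquad dF^a=0 .$$ *The branes.* Consider ten branes $s=1,\dots,10$: electric branes $1,2,3,4,5,6,8,9$ of $F^5$ (so $a_s=5$), the electric brane $7$ of $F^6$ ($a_7=6$) and the magnetic brane $10$ of $F^4$ ($a_{10}=4$), with $\chi_s=1$ for $s\le9$, $\chi_{10}=-1$, and brane sets in $\{1,\dots,15\}$ $$I_1=\{3,4,10,12\},\ I_2=\{1,6,7,12\},\ I_3=\{8,9,10,12\},\ I_4=\{1,2,3,12\},\ I_5=\{5,6,10,12\},$$ $$I_6=\{1,4,8,12\},\ I_7=\{2,7,10,12,13\},\ I_8=\{3,6,8,12\},\ I_9=\{1,10,11,12\},\ I_{10}=\{1,\dots,11\}.$$ Put $d(I)=|I|$. Let $U^s=(\delta_{iI_s},-\chi_s\lambda_{a_s\alpha})\in\mathbb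 R^{15+5}$, where $\delta_{iI}=1$ if $i\in I$ and $0$ otherwise, and let $(U^s,U^{s'})=\hat G^{AB}U^s_AU^{s'}_B$, where $(\hat G^{AB})$ is the inverse of the block-diagonal matrix with blocks $(\delta_{ij}-1)_{i,j\le15}$ and $(-\delta_{\alpha\beta})_{\alpha,\beta\le5}$. Write $U^s(c)=\sum_{i\in I_s}c^i-\chi_s\sum_\alpha\lambda_{a_s\alpha}c^\alpha_\varphi$. Let $A=(A_{ss'})$ be the Cartan matrix of the Kac–Moody algebra $E_{10}$: $A_{ss}=2$, $A_{ss'}=-1$ if $s,s'$ are joined in the Dynkin diagram consisting of the chain $1-2-\cdots-9$ and a node $10$ joined to $7$, and $A_{ss'}=0$ otherwise. **(i) Intersection rules.** $(U^s,U^s)=2$ for all $s$, $\;2(U^s,U^{s'})/(U^{s'},U^{s'})=A_{ss'}$ for all $s,s'$, and for $s\ne s'$ $$d(I_s\cap I_{s'})=\Delta(s,s')+A_{ss'},\qquad \Delta(s,s')=\frac{d(I_s)d(I_{s'})}{14}+\chi_s\chi_{s'}\,\vec\lambda_{a_s}\cdot\vec\lambda_{a_{s'}} .$$ **(ii) The solution.**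 Let $J\subset\mathbb R$ be an open interval, $Q_s\neq0$ real constants, and let $q^s$ satisfy the $E_{10}$ Toda equations on $J$, $$\ddot q^s=-2Q_s^2\exp\Big(\sum_{s'=1}^{10}A_{ss'}q^{s'}\Big),\qquad s=1,\dots,10 .$$ Then $$E_T=\frac18\sum_{s,s'}A_{ss'}\dot q^s\dot q^{s'}+\frac12\sum_sQ_s^2\exp\Big(\sum_{s'}A_{ss'}q^{s'}\Big)$$ is constant on $J$. Let the constants $c^0,\dots,c^{15},c_\varphi^1,\dots,c_\varphi^5$ and $\bar c^0,\dots,\bar c^{15},\bar c_\varphi^1,\dots,\bar c_\varphi^5$ satisfy $$c^0=\sum_{j=1}^{15}c^j,\quad \bar c^0=\sum_{j=1}^{15}\bar c^j,\quad U^s(c)=U^s(\bar c)=0\ (s=1,\dots,10),\quad 2E_T-\sum_\alpha(c_\varphi^\alpha)^2+\sum_{i=1}^{15}(c^i)^2-\Big(\sum_{i=1}^{15}c^i\Big)^2=0 .$$ With $f_s=e^{-q^s(t)}$, the smooth fields on $J\times\mathbb R^{15}$ (coordinates $t,x^1,\dots,x^{15}$) $$g=\Big(\prod_sf_s^{d(I_s)/14}\Big)\Big\{-e^{2c^0t+2\bar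 c^0}dt\otimes dt+\sum_{i=1}^{15}\Big(\prod_{s:\,i\in I_s}f_s^{-1}\Big)e^{2c^it+2\bar c^i}dx^i\otimes dx^i\Big\},$$ $$\varphi^\alpha=\frac12\Big[-\lambda_{5\alpha}\sum_{s\ne7,10}\ln f_s-\lambda_{6\alpha}\ln f_7+\lambda_{4\alpha}\ln f_{10}\Big]+c_\varphi^\alpha t+\bar c_\varphi^\alpha,$$ $$F^4=Q_{10}\,dx^{12}\wedge dx^{13}\wedge dx^{14}\wedge dx^{15},\qquad F^a=\sum_{s\le 9,\ a_s=a}Q_s\Big(\prod_{s'}f_{s'}^{-A_{ss'}}\Big)dt\wedge\tau(I_s)\ (a=5,6),\qquad F^7=F^8=F^9=0,$$ where $\tau(\{i_1<\dots<i_k\})=dx^{i_1}\wedge\dots\wedge dx^{i_k}$, solve the field equations and Bianchi identities of the $B_{16}$-model, and $g$ has signature $(-,+,\dots,+)$. **(iii) Special one-block solution.** The matrix $A$ is invertible; with $(A^{ss'})=A^{-1}$, the numbers $b_s=2\sum_{s'}A^{ss'}$ are $$(b_1,\dots,b_{10})=(-60,-122,-186,-252,-320,-390,-462,-306,-152,-230),\qquad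 \sum_sb_s=-2480 .$$ Let $Q\ne0$, $C,t_0\in\mathbb R$, $Q_s^2=Q^2|b_s|$, and $$\bar f(t)=\begin{cases}|Q|\sqrt{2/C}\,\sinh(\sqrt C(t-t_0)),&C>0,\\ |Q|\sqrt{2/|C|}\,\sin(\sqrt{|C|}(t-t_0)),&C<0,\\ |Q|\sqrt2\,(t-t_0),&C=0.\end{cases}$$ On every open set $J\subset\mathbb R$ on which $\bar f$ has no zeros, $f_s=\bar f^{\,b_s}$ is positive, $q^s=-\ln f_s$ solve the Toda equations of (ii), and $E_T=-620\,C$. Hence, for constants $c,\bar c$ obeying the constraints of (ii) with $E_T=-620\,C$, the fields of (ii) with $f_s=\bar f^{\,b_s}$ solve the field equations and Bianchi identities; moreover $Q_s\prod_{s'}f_{s'}^{-A_{ss'}}=Q_s\bar f^{-2}$ for $s=1,\dots,9$. **(iv) One harmonic function.** Let $C=0$, let all $c^i,\bar c^i,c^\alpha_\varphi,\bar c_\varphi^\alpha$ vanish, $Q_s^2=Q^2|b_s|$, and put $H=\bar f=|Q|\sqrt2(t-t_0)>0$ for $t>t_0$. If real numbers $\nu_s$ satisfy $\sum_{s'}(U^s,U^{s'})\nu_{s'}^2=-1$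 and $\operatorname{sign}\nu_s=-\operatorname{sign}Q_s$ for all $s$, then the solution of (iii) on $(t_0,\infty)\times\mathbb R^{15}$ coincides with $$g=\Big(\prod_sH^{2d(I_s)\nu_s^2}\Big)^{-1/14}\Big\{-dt\otimes dt+\sum_{i=1}^{15}\Big(\prod_sH^{2\nu_s^2\delta_{iI_s}}\Big)dx^i\otimes dx^i\Big\},\qquad \varphi^\alpha=\sum_s\chi_s\lambda_{a_s\alpha}\nu_s^2\ln H,$$ $$F^a=\sum_{s\le9,\ a_s=a}\nu_s\,dH^{-1}\wedge\tau(I_s)\ (a=5,6),\qquad F^4=\nu_{10}\,(*_0dH)\wedge\tau(\{12,13,14,15\}),\qquad F^7=F^8=F^9=0,$$ where $*_0dt=-1$; in particular these fields solve the field equations and Bianchi identities. -/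

import Mathlib

open Set Matrix
open scoped ContDiff Nat

noncomputable section

/-! ### Differential geometry in global coordinates `x 0, x 1, …, x 15` on (open subsets of) `ℝ¹⁶` -/

/-- Points of the coordinate space `ℝ¹⁶`; `x 0 = t` and `x i = xⁱ` for `i = 1, …, 15`. -/
abbrev Pt : Type := Fin 16 → ℝ

/-- The partial derivative `∂f/∂x^μ`. -/
def pd (μ : Fin 16) (f : Pt → ℝ) (x : Pt) : ℝ := fderiv ℝ f x (Pi.single μ 1)

/-- A field of covariant metric components `g_{MN}`. -/
abbrev MetricField : Type := Pt → Matrix (Fin 16) (Fin 16) ℝ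

/-- A symmetric matrix of signature `(-,+,…,+)`. -/
def IsLorentzian (G : Matrix (Fin 16) (Fin 16) ℝ) : Prop :=
  G.IsSymm ∧ ∃ P : Matrix (Fin 16) (Fin 16) ℝ, IsUnit P.det ∧
    Pᵀ * G * P = Matrix.diagonal fun μ => if μ = 0 then (-1 : ℝ) else 1

/-- Christoffel symbols `Γ^L_{MN}` of the Levi-Civita connection. -/
def christoffel (g : MetricField) (L M N : Fin 16) (x : Pt) : ℝ :=
  (1 / 2) * ∑ K, (g x)⁻¹ L K *
    (pd M (fun y => g y K N) x + pd N (fun y => g y K M) x - pd K (fun y => g y M N) x)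

/-- The Ricci tensor `R_{MN}[g]` (positive on round spheres). -/
def ricci (g : MetricField) (M N : Fin 16) (x : Pt) : ℝ :=
  ∑ L, (pd L (christoffel g L M N) x - pd N (christoffel g L M L) x)
    + ∑ L, ∑ K, (christoffel g L L K x * christoffel g K M N x
      - christoffel g L N K x * christoffel g K M L x)

/-- The scalar curvature `R[g]`. -/
def scalarCurv (g : MetricField) (x : Pt) : ℝ := ∑ M, ∑ N, (g x)⁻¹ M N * ricci g M N x

/-- `√|g|`. -/
def volDensity (g : MetricField) (x : Pt) : ℝ := Real.sqrt |(g x).det|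

/-- `g^{MN} ∂_M u ∂_N v`. -/
def gradInner (g : MetricField) (u v : Pt → ℝ) (x : Pt) : ℝ :=
  ∑ M, ∑ N, (g x)⁻¹ M N * pd M u x * pd N v x

/-- The Laplace–Beltrami operator `|g|^{-1/2} ∂_M (|g|^{1/2} g^{MN} ∂_N u)`. -/
def laplaceBeltrami (g : MetricField) (u : Pt → ℝ) (x : Pt) : ℝ :=
  (volDensity g x)⁻¹ * ∑ M, pd M (fun y => volDensity g y * ∑ N, (g y)⁻¹ M N * pd N u y) x

/-- A differential `a`-form on `ℝ¹⁶`. -/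
abbrev DForm (a : ℕ) : Type := Pt → Pt [⋀^Fin a]→L[ℝ] ℝ

/-- The component `F_{M₁…M_a} = F(∂_{M₁}, …, ∂_{M_a})`. -/
def formComp {a : ℕ} (F : DForm a) (x : Pt) (K : Fin a → Fin 16) : ℝ :=
  F x fun i => Pi.single (K i) 1

/-- The component `F^{M₁…M_a}` with all indices raised by `g`. -/
def compUp {a : ℕ} (g : MetricField) (F : DForm a) (x : Pt) (K : Fin a → Fin 16) : ℝ :=
  ∑ L : Fin a → Fin 16, (∏ i, (g x)⁻¹ (K i) (L i)) * formComp F x L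

/-- `(F)²_g = F_{M₁…M_a} F_{N₁…N_a} g^{M₁N₁} ⋯ g^{M_aN_a}`. -/
def formSq {a : ℕ} (g : MetricField) (F : DForm a) (x : Pt) : ℝ :=
  ∑ K : Fin a → Fin 16, formComp F x K * compUp g F x K

/-- `F_{M M₂…M_a} F_N{}^{M₂…M_a}` for a form of degree `a = n + 1`. -/
def formContract {n : ℕ} (g : MetricField) (F : DForm (n + 1)) (M N : Fin 16) (x : Pt) : ℝ :=
  ∑ K : Fin n → Fin 16, ∑ L : Fin n → Fin 16,
    formComp F x (Fin.cons M K) * formComp F x (Fin.cons N L) * ∏ i, (g x)⁻¹ (K i) (L i)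

/-! ### The `B₁₆`-model

The action is
`S = ∫ d¹⁶z √|g| { R[g] + g^{MN} ∂_M φ·∂_N φ - ∑_{a=4}^{9} (1/a!) exp(2 λ_a·φ) (F^a)² }`,
with scalar fields `φ¹, …, φ⁵` and forms `F^a` of degree `a = 4, …, 9`. -/

/-- The dilatonic coupling vectors `λ₄, …, λ₉ ∈ ℝ⁵` of the `B₁₆`-model:
`λ_a·λ_b = min(a,b) - 3 - (a-1)(b-1)/14` and `λ₉ = -2 λ₄`. -/
structure IsB16Coupling (lam : ℕ → Fin 5 → ℝ) : Prop where
  gram : ∀ a ∈ Finset.Icc 4 9, ∀ b ∈ Finset.Icc 4 9,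
    lam a ⬝ᵥ lam b = min (a : ℝ) b - 3 - ((a : ℝ) - 1) * ((b : ℝ) - 1) / 14
  last : lam 9 = (-2 : ℝ) • lam 4

/-- `exp(2 λ_a(φ))`. -/
def dilatonFactor (lam : ℕ → Fin 5 → ℝ) (phi : Fin 5 → Pt → ℝ) (a : ℕ) (x : Pt) : ℝ :=
  Real.exp (2 * ∑ α, lam a α * phi α x)

/-- The energy-momentum tensor `T_{MN}` of the `B₁₆`-model (the degree of the forms is
`a = n + 1`, `a = 4, …, 9`). -/
def stressTensor (lam : ℕ → Fin 5 → ℝ) (g : MetricField) (phi : Fin 5 → Pt → ℝ)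
    (F : (a : ℕ) → DForm a) (M N : Fin 16) (x : Pt) : ℝ :=
  -(∑ α, (pd M (phi α) x * pd N (phi α) x
      - (1 / 2) * g x M N * gradInner g (phi α) (phi α) x))
    + ∑ n ∈ Finset.Icc 3 8, dilatonFactor lam phi (n + 1) x / ((n + 1)! : ℝ) *
        (((n : ℝ) + 1) * formContract g (F (n + 1)) M N x
          - (1 / 2) * g x M N * formSq g (F (n + 1)) x)

/-- `(g, φ, F)` is a smooth solution, on the open set `W ⊆ ℝ¹⁶`, of the field equations of the
`B₁₆`-model with metric of signature `(-,+,…,+)`: the Einstein equations, the scalar field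
equations, the generalized Maxwell equations and the Bianchi identities `dF^a = 0`. -/
structure SolvesB16 (lam : ℕ → Fin 5 → ℝ) (W : Set Pt) (g : MetricField)
    (phi : Fin 5 → Pt → ℝ) (F : (a : ℕ) → DForm a) : Prop where
  smooth_metric : ∀ M N, ContDiffOn ℝ ∞ (fun x => g x M N) W
  smooth_scalar : ∀ α, ContDiffOn ℝ ∞ (phi α) W
  smooth_form : ∀ a ∈ Finset.Icc 4 9, ContDiffOn ℝ ∞ (F a) W
  lorentzian : ∀ x ∈ W, IsLorentzian (g x)
  einstein : ∀ x ∈ W, ∀ M N,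
    ricci g M N x - (1 / 2) * g x M N * scalarCurv g x = stressTensor lam g phi F M N x
  scalar : ∀ x ∈ W, ∀ α,
    laplaceBeltrami g (phi α) x
      + ∑ a ∈ Finset.Icc 4 9,
          lam a α / (a ! : ℝ) * dilatonFactor lam phi a x * formSq g (F a) x = 0
  maxwell : ∀ x ∈ W, ∀ n ∈ Finset.Icc 3 8, ∀ K : Fin n → Fin 16,
    ∑ M, pd M (fun y => volDensity g y * dilatonFactor lam phi (n + 1) y *
      compUp g (F (n + 1)) y (Fin.cons M K)) x = 0
  bianchi : ∀ x ∈ W, ∀ a ∈ Finset.Icc 4 9, extDeriv (F a) x = 0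

/-! ### The brane configuration

The ten branes `s₁, …, s₁₀` are labelled by `Fin 10`, read modulo ten: `s_k` has the label `k` for
`k = 1, …, 9`, and `s₁₀` has the label `0` (which is what the numeral `10 : Fin 10` denotes). -/

/-- The brane sets `I_s ⊆ {1, …, 15}`. -/
def braneSet : Fin 10 → Finset (Fin 16)
  | 1 => {3, 4, 10, 12}
  | 2 => {1, 6, 7, 12}
  | 3 => {8, 9, 10, 12}
  | 4 => {1, 2, 3, 12}
  | 5 => {5, 6, 10, 12}
  | 6 => {1, 4, 8, 12}
  | 7 => {2, 7, 10, 12, 13}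
  | 8 => {3, 6, 8, 12}
  | 9 => {1, 10, 11, 12}
  | 0 => {1, 2, 3, 4, 5, 6, 7, 8, 9, 10, 11}

/-- The degree `a_s` of the form `F^{a_s}` to which the brane `s` belongs. -/
def colour : Fin 10 → ℕ
  | 7 => 6
  | 0 => 4
  | _ => 5

/-- `χ_s = 1` for the nine electric branes and `χ_s = -1` for the magnetic brane `s₁₀`. -/
def chi : Fin 10 → ℝ
  | 0 => -1
  | _ => 1

/-- The worldvolume dimension `d(I_s)` (all factor spaces are one-dimensional). -/
def dimI (s : Fin 10) : ℝ := ((braneSet s).card : ℝ)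

/-- Edges of the Dynkin diagram of `E₁₀`: the chain `1 - 2 - ⋯ - 9`, and `10` attached to `7`. -/
def e10Edges : Finset (Sym2 (Fin 10)) :=
  {s(1, 2), s(2, 3), s(3, 4), s(4, 5), s(5, 6), s(6, 7), s(7, 8), s(8, 9), s(7, 10)}

/-- The (simply laced) Cartan matrix of the hyperbolic Kac–Moody algebra `E₁₀`. -/
def e10 : Matrix (Fin 10) (Fin 10) ℤ :=
  Matrix.of fun s s' => if s = s' then 2 else if s(s, s') ∈ e10Edges then -1 else 0

/-- The target space metric `Ĝ` on `(φⁱ, φ^α)`: `G_{ij} = δ_{ij} - 1`, `h_{αβ} = -δ_{αβ}`. -/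
def targetMetric : Matrix (Fin 15 ⊕ Fin 5) (Fin 15 ⊕ Fin 5) ℝ :=
  Matrix.fromBlocks (Matrix.of fun i j => (if i = j then 1 else 0) - 1) 0 0 (-1)

/-- The brane co-vector `U^s = (δ_{iI_s}, -χ_s λ_{a_s α})`. -/
def braneVec (lam : ℕ → Fin 5 → ℝ) (s : Fin 10) : Fin 15 ⊕ Fin 5 → ℝ :=
  Sum.elim (fun i => if i.succ ∈ braneSet s then 1 else 0)
    (fun α => -chi s * lam (colour s) α)

/-- The scalar product `(U^s, U^{s'}) = Ĝ^{AB} U^s_A U^{s'}_B`. -/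
def braneProd (lam : ℕ → Fin 5 → ℝ) (s s' : Fin 10) : ℝ :=
  braneVec lam s ⬝ᵥ (targetMetric⁻¹ *ᵥ braneVec lam s')

/-- The orthogonal intersection number
`Δ(s,s') = d(I_s) d(I_{s'})/(D-2) - χ_s χ_{s'} λ_{a_s α} λ_{a_{s'} β} h^{αβ}`,
with `D = 16`, `h^{αβ} = -δ^{αβ}`. -/
def orthoIntersection (lam : ℕ → Fin 5 → ℝ) (s s' : Fin 10) : ℝ :=
  dimI s * dimI s' / 14 + chi s * chi s' * (lam (colour s) ⬝ᵥ lam (colour s'))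

/-! ### Toda equations and integration constants -/

/-- `q^s` obey the `E₁₀` Toda equations `q̈^s = -2 Q_s² exp(∑ A_{ss'} q^{s'})` on `J`. -/
def IsTodaSolution (Q : Fin 10 → ℝ) (J : Set ℝ) (q : Fin 10 → ℝ → ℝ) : Prop :=
  ∀ s, ∀ t ∈ J, DifferentiableAt ℝ (q s) t ∧
    HasDerivAt (deriv (q s))
      (-2 * Q s ^ 2 * Real.exp (∑ s', (e10 s s' : ℝ) * q s' t)) t

/-- The energy `E_T` of the Toda chain. -/
def todaEnergy (Q : Fin 10 → ℝ) (q : Fin 10 → ℝ → ℝ) (t : ℝ) : ℝ :=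
  (1 / 8) * ∑ s, ∑ s', (e10 s s' : ℝ) * deriv (q s) t * deriv (q s') t
    + (1 / 2) * ∑ s, Q s ^ 2 * Real.exp (∑ s', (e10 s s' : ℝ) * q s' t)

/-- The linear constraints on a set of constants `(c⁰, c¹, …, c¹⁵; c_φ¹, …, c_φ⁵)`:
`c⁰ = ∑_{j=1}^{15} c^j` and `U^s(c) = ∑_{i ∈ I_s} cⁱ - χ_s ∑_α λ_{a_s α} c_φ^α = 0`. -/
structure LinearConstraints (lam : ℕ → Fin 5 → ℝ) (c : Fin 16 → ℝ) (cphi : Fin 5 → ℝ) :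
    Prop where
  zero : c 0 = ∑ j : Fin 15, c j.succ
  brane : ∀ s, braneVec lam s ⬝ᵥ Sum.elim (fun i : Fin 15 => c i.succ) cphi = 0

/-- `-∑ (c_φ^α)² + ∑ (cⁱ)² - (∑ cⁱ)²`. -/
def constNorm (c : Fin 16 → ℝ) (cphi : Fin 5 → ℝ) : ℝ :=
  -∑ α, cphi α ^ 2 + ∑ i : Fin 15, c i.succ ^ 2 - (∑ i : Fin 15, c i.succ) ^ 2

/-! ### The fields of the solution -/

/-- The region `J × ℝ¹⁵` of space-time. -/
def region (J : Set ℝ) : Set Pt := {x | x 0 ∈ J}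

/-- The metric
`(∏_s f_s^{d(I_s)/14}) { -e^{2c⁰t+2c̄⁰} dt² + ∑_{i=1}^{15} (∏_{s : i ∈ I_s} f_s^{-1})
e^{2cⁱt+2c̄ⁱ} (dxⁱ)² }`
(no `I_s` contains the index `0` of the time coordinate). -/
def braneMetric (f : Fin 10 → ℝ → ℝ) (c cbar : Fin 16 → ℝ) : MetricField := fun x =>
  (∏ s, f s (x 0) ^ (dimI s / 14)) •
    Matrix.diagonal fun μ => (if μ = 0 then (-1 : ℝ) else 1) *
      (∏ s with μ ∈ braneSet s, (f s (x 0))⁻¹) * Real.exp (2 * c μ * x 0 + 2 * cbar μ)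

/-- The scalar fields
`φ^α = ½ ∑_s χ_s (-λ_{a_s α}) ln f_s + c_φ^α t + c̄_φ^α`. -/
def braneScalar (lam : ℕ → Fin 5 → ℝ) (f : Fin 10 → ℝ → ℝ) (cphi cphibar : Fin 5 → ℝ)
    (α : Fin 5) (x : Pt) : ℝ :=
  (1 / 2) * ∑ s, chi s * (-lam (colour s) α) * Real.log (f s (x 0)) + cphi α * x 0 + cphibar α

/-- The constant form `dx^{k 0} ∧ ⋯ ∧ dx^{k (a-1)}`. -/
def dxTuple {a : ℕ} (k : Fin a → Fin 16) : Pt [⋀^Fin a]→L[ℝ] ℝ :=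
  { (Matrix.detRowAlternating (R := ℝ) (n := Fin a)).compLinearMap (LinearMap.funLeft ℝ ℝ k) with
    cont := by
      change Continuous fun v : Fin a → Pt => Matrix.det (Matrix.of fun i j => v i (k j))
      fun_prop }

theorem dxTuple_apply {a : ℕ} (k : Fin a → Fin 16) (v : Fin a → Pt) :
    dxTuple k v = Matrix.det (Matrix.of fun i j => v i (k j)) := rfl

/-- The form `dx^{i₁} ∧ ⋯ ∧ dx^{i_a}` for `T = {i₁ < ⋯ < i_a}`. -/
def dxSet (a : ℕ) (T : Finset (Fin 16)) : Pt [⋀^Fin a]→L[ℝ] ℝ :=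
  if h : T.card = a then dxTuple (T.orderEmbOfFin h) else 0

/-- The coordinates entering the elementary form of the brane `s`: `dt ∧ τ(I_s)` for an electric
brane, and `τ(Ī_s)`, `Ī_s = {1, …, 15} \ I_s`, for the magnetic brane `s₁₀`. -/
def formSupport (s : Fin 10) : Finset (Fin 16) :=
  if s = 10 then Finset.univ \ insert 0 (braneSet s) else insert 0 (braneSet s)

/-- The forms `F^a = ∑_{s : a_s = a} k_s dt ∧ τ(I_s)` (with `τ(Ī_s)` in place of `dt ∧ τ(I_s)` for
the magnetic brane), for coefficient functions `k_s` of `t`. -/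
def braneForm (k : Fin 10 → ℝ → ℝ) (a : ℕ) : DForm a := fun x =>
  ∑ s with colour s = a, k s (x 0) • dxSet a (formSupport s)

/-- The coefficients `Q_s ∏_{s'} f_{s'}^{-A_{ss'}}` of the electric branes, and `Q_{10}`. -/
def braneCoeff (Q : Fin 10 → ℝ) (f : Fin 10 → ℝ → ℝ) (s : Fin 10) (t : ℝ) : ℝ :=
  if s = 10 then Q s else Q s * ∏ s', f s' t ^ (-e10 s s')

/-! ### The special one-block solution -/

/-- The integers `b_s`. -/
def bNum : Fin 10 → ℤ
  | 1 => -60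
  | 2 => -122
  | 3 => -186
  | 4 => -252
  | 5 => -320
  | 6 => -390
  | 7 => -462
  | 8 => -306
  | 9 => -152
  | 0 => -230

/-- The function `f̄`; here `q` stands for the constant `Q`. -/
def fbar (q C t₀ t : ℝ) : ℝ :=
  if 0 < C then |q| * Real.sqrt (2 / C) * Real.sinh (Real.sqrt C * (t - t₀))
  else if C < 0 then |q| * Real.sqrt (2 / |C|) * Real.sin (Real.sqrt |C| * (t - t₀))
  else |q| * Real.sqrt 2 * (t - t₀)

/-- The metric of the one-block solution with one function `H` of `t`:
`(∏_s H^{2 d(I_s) ν_s²})^{1/(2-D)} { -dt² + ∑_i (∏_s H^{2 ν_s² δ_{iI_s}}) (dxⁱ)² }`, `D = 16`. -/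
def harmonicMetric (ν : Fin 10 → ℝ) (H : ℝ → ℝ) : MetricField := fun x =>
  (∏ s, H (x 0) ^ (2 * dimI s * ν s ^ 2)) ^ (1 / (2 - 16) : ℝ) •
    Matrix.diagonal fun μ => if μ = 0 then (-1 : ℝ) else
      ∏ s, H (x 0) ^ (2 * ν s ^ 2 * (if μ ∈ braneSet s then 1 else 0))

/-- The scalar fields `φ^α = -∑_s λ_{a_s}^α χ_s ν_s² ln H`, where `λ_a^α = -λ_{aα}`. -/
def harmonicScalar (lam : ℕ → Fin 5 → ℝ) (ν : Fin 10 → ℝ) (H : ℝ → ℝ) (α : Fin 5) (x : Pt) : ℝ :=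
  -∑ s, (-lam (colour s) α) * chi s * ν s ^ 2 * Real.log (H (x 0))

/-- The coefficients of `ν_s dH^{-1} ∧ τ(I_s)` (electric) and of `ν_s (*₀ dH) ∧ τ(Ī_s)` (magnetic),
where `*₀ dt = -1` for the metric `-dt ⊗ dt`. -/
def harmonicCoeff (ν : Fin 10 → ℝ) (H : ℝ → ℝ) (s : Fin 10) (t : ℝ) : ℝ :=
  if s = 10 then ν s * (-deriv H t) else ν s * deriv (fun τ => (H τ)⁻¹) t

end

/-! All fields depend on `t` only, so the field equations become ordinary differential equations.
The metric is diagonal, with entries `∓e^{2γ^μ}`, and the constraints `c⁰ = ∑ cʲ`, `c̄⁰ = ∑ c̄ʲ` put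
it in the harmonic gauge `γ⁰ = ∑ γⁱ`. There `√|g| g⁰⁰` is constant, the Laplacian of a function of
`t` is `-e^{-2γ⁰}` times its second derivative, and `R_ii` is proportional to the second derivative
of `γⁱ` (`ricci_timeMetric`, `laplaceBeltrami_time`).

The exponents `(γⁱ, φ^α)` form the vector `∑ ½ q^s Ĝ⁻¹U^s + ct + c̄` of the target space. The
intersection rules, a finite integer check, say precisely that `(U^s, U^{s'}) = A_{ss'}`. Since
`U^s` kills `c` and `c̄`, it takes the value `½ ∑ A_{ss'} q^{s'}` on the exponents. Hence every
brane, electric or magnetic, enters the equations through `B_s = Q_s² exp(∑ A_{ss'} q^{s'})` times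
`e^{-2γ⁰}` and a sign (`dilaton_mul_coeff_sq`). The scalar equations are then combinations of the
Toda equations. The `tt` Einstein equation is the energy constraint, by `kinetic_eq`, and the
spatial diagonal ones follow from the Toda equations and this constraint. The off-diagonal ones hold
because the supports of two branes of equal degree differ in at least two indices. The Maxwell and
Bianchi equations hold because the electric flux densities are constant and contain `dt`, while the
magnetic form is constant and does not.

For the one-block solution, `∑ A_{ss'} b_{s'} = 2` collapses the ten Toda equations for `q^s = -b_s
ln |f̄|` to a single Liouville equation, with first integral `f̄'² - C f̄² = 2Q²`. For the harmonic
form, invertibility of `A` forces `ν_s² = -b_s/2`, and the sign condition then gives `Q_s = -√2 |Q|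
ν_s`. -/

section

open Filter Topology

/-! ### Diagonal metrics depending on time only -/

/-- The signature `(-,+,…,+)`. -/
def sgn (μ : Fin 16) : ℝ := if μ = 0 then -1 else 1

@[simp] theorem sgn_zero : sgn 0 = -1 := rfl

@[simp] theorem sgn_succ (i : Fin 15) : sgn i.succ = 1 := if_neg (Fin.succ_ne_zero i)

theorem sgn_mul_self (μ : Fin 16) : sgn μ * sgn μ = 1 := by
  unfold sgn; split_ifs <;> norm_num

/-- The diagonal metric `-e^{2γ⁰}dt² + ∑ e^{2γⁱ}(dxⁱ)²` with `γ` depending on `t` only. -/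
noncomputable def timeMetric (γ : Fin 16 → ℝ → ℝ) : MetricField := fun x =>
  Matrix.diagonal fun μ => sgn μ * Real.exp (2 * γ μ (x 0))

theorem timeMetric_inv (γ : Fin 16 → ℝ → ℝ) (x : Pt) :
    (timeMetric γ x)⁻¹ = Matrix.diagonal fun μ => sgn μ * Real.exp (-(2 * γ μ (x 0))) := by
  refine Matrix.inv_eq_right_inv ?_
  rw [timeMetric, Matrix.diagonal_mul_diagonal, ← Matrix.diagonal_one]
  congr 1
  funext μ
  rw [mul_mul_mul_comm, sgn_mul_self, ← Real.exp_add]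
  simp

theorem isLorentzian_timeMetric (γ : Fin 16 → ℝ → ℝ) (x : Pt) :
    IsLorentzian (timeMetric γ x) := by
  refine ⟨Matrix.diagonal_transpose _,
    -- Rescaling each coordinate vector to unit length.
    Matrix.diagonal fun μ => Real.exp (-γ μ (x 0)), ?_, ?_⟩
  · rw [Matrix.det_diagonal]
    exact (Finset.prod_ne_zero_iff.mpr fun μ _ => (Real.exp_pos _).ne').isUnit
  · rw [timeMetric, Matrix.diagonal_transpose, Matrix.diagonal_mul_diagonal,
      Matrix.diagonal_mul_diagonal]
    congr 1
    funext μ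
    have : Real.exp (-γ μ (x 0)) * Real.exp (2 * γ μ (x 0)) * Real.exp (-γ μ (x 0)) = 1 := by
      rw [← Real.exp_add, ← Real.exp_add]
      ring_nf
      exact Real.exp_zero
    calc _ = sgn μ * (Real.exp (-γ μ (x 0)) * Real.exp (2 * γ μ (x 0))
          * Real.exp (-γ μ (x 0))) := by ring
      _ = _ := by rw [this, mul_one, sgn]

theorem volDensity_timeMetric (γ : Fin 16 → ℝ → ℝ) (x : Pt) :
    volDensity (timeMetric γ) x = Real.exp (∑ μ, γ μ (x 0)) := by
  have habs : ∀ μ, |sgn μ| = 1 := fun μ => by unfold sgn; split_ifs <;> simp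
  rw [volDensity, timeMetric, Matrix.det_diagonal, Finset.abs_prod]
  simp only [abs_mul, habs, one_mul, Real.abs_exp]
  rw [← Real.exp_sum, ← Finset.mul_sum, two_mul, Real.exp_add,
    Real.sqrt_mul_self (Real.exp_pos _).le]

theorem isOpen_region {J : Set ℝ} (hJ : IsOpen J) : IsOpen (region J) :=
  hJ.preimage (continuous_apply 0)

/-! ### Partial derivatives -/

theorem pd_congr {u v : Pt → ℝ} {x : Pt} (h : u =ᶠ[𝓝 x] v) (μ : Fin 16) : pd μ u x = pd μ v x := by
  rw [pd, pd, h.fderiv_eq]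

theorem pd_time {v : ℝ → ℝ} {v' : ℝ} {x : Pt} (h : HasDerivAt v v' (x 0)) (μ : Fin 16) :
    pd μ (fun y => v (y 0)) x = if μ = 0 then v' else 0 := by
  have h1 : HasFDerivAt (fun y : Pt => y 0) (ContinuousLinearMap.proj (R := ℝ) (0 : Fin 16)) x :=
    hasFDerivAt_apply 0 x
  have h2 := h.comp_hasFDerivAt x h1
  have h3 : HasFDerivAt (fun y : Pt => v (y 0)) _ x := h2
  rw [pd, h3.fderiv]
  by_cases hμ : μ = 0
  · subst hμ; simp
  · simp [hμ, Ne.symm hμ]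

theorem pd_time_of_eqOn {J : Set ℝ} (hJ : IsOpen J) {u : Pt → ℝ} {v : ℝ → ℝ} {v' : ℝ} {x : Pt}
    (hx : x ∈ region J) (hu : ∀ y ∈ region J, u y = v (y 0)) (h : HasDerivAt v v' (x 0))
    (μ : Fin 16) : pd μ u x = if μ = 0 then v' else 0 := by
  rw [← pd_time h]
  exact pd_congr (Filter.eventually_of_mem ((isOpen_region hJ).mem_nhds hx) hu) μ

theorem pd_const (c : ℝ) (μ : Fin 16) (x : Pt) : pd μ (fun _ => c) x = 0 := by
  simp [pd]

/-! ### Curvature of a diagonal metric depending on time only -/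

section curvature

variable {J : Set ℝ} {γ γ1 γ2 : Fin 16 → ℝ → ℝ}

theorem pd_timeMetric (h1 : ∀ μ, ∀ t ∈ J, HasDerivAt (γ μ) (γ1 μ t) t) {x : Pt}
    (hx : x ∈ region J) (K M N : Fin 16) :
    pd K (fun y => timeMetric γ y M N) x =
      if K = 0 ∧ M = N then 2 * γ1 M (x 0) * (sgn M * Real.exp (2 * γ M (x 0))) else 0 := by
  by_cases hMN : M = N
  · subst hMN
    have : HasDerivAt (fun t => sgn M * Real.exp (2 * γ M t))
        (sgn M * (Real.exp (2 * γ M (x 0)) * (2 * γ1 M (x 0)))) (x 0) :=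
      (((h1 M _ hx).const_mul 2).exp).const_mul _
    simp only [timeMetric, Matrix.diagonal_apply_eq, and_true]
    rw [pd_time this]
    split_ifs <;> ring
  · simp only [timeMetric, Matrix.diagonal_apply_ne _ hMN, hMN, and_false, if_false, pd_const]

/-- The three cases overlap exactly when all indices are `0`. There they contribute `1 + 1 - 1`
because `sgn 0 = -1`, which is the correct value `γ1 0`. -/
theorem christoffel_timeMetric (h1 : ∀ μ, ∀ t ∈ J, HasDerivAt (γ μ) (γ1 μ t) t) {x : Pt}
    (hx : x ∈ region J) (L M N : Fin 16) :
    christoffel (timeMetric γ) L M N x =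
      (if M = 0 ∧ L = N then γ1 L (x 0) else 0) + (if N = 0 ∧ L = M then γ1 L (x 0) else 0)
      + (if L = 0 ∧ M = N then γ1 M (x 0) * sgn M * Real.exp (2 * γ M (x 0) - 2 * γ 0 (x 0))
          else 0) := by
  rw [christoffel, timeMetric_inv, Finset.sum_eq_single L
    (fun K _ hK => by rw [Matrix.diagonal_apply_ne _ (Ne.symm hK), zero_mul])
    (fun h => absurd (Finset.mem_univ _) h), Matrix.diagonal_apply_eq,
    pd_timeMetric h1 hx, pd_timeMetric h1 hx, pd_timeMetric h1 hx]
  have e1 : sgn L * Real.exp (-(2 * γ L (x 0))) * (sgn L * Real.exp (2 * γ L (x 0))) = 1 := by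
    rw [mul_mul_mul_comm, sgn_mul_self, ← Real.exp_add]; simp
  have a1 : ∀ K : Fin 16, (1 / 2 : ℝ) * (sgn L * Real.exp (-(2 * γ L (x 0))) *
      (if K = 0 ∧ L = N then 2 * γ1 L (x 0) * (sgn L * Real.exp (2 * γ L (x 0))) else 0)) =
      if K = 0 ∧ L = N then γ1 L (x 0) else 0 := fun K => by
    split_ifs
    · linear_combination (γ1 L (x 0)) * e1
    · ring
  have a2 : ∀ K : Fin 16, (1 / 2 : ℝ) * (sgn L * Real.exp (-(2 * γ L (x 0))) *
      (if K = 0 ∧ L = M then 2 * γ1 L (x 0) * (sgn L * Real.exp (2 * γ L (x 0))) else 0)) =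
      if K = 0 ∧ L = M then γ1 L (x 0) else 0 := fun K => by
    split_ifs
    · linear_combination (γ1 L (x 0)) * e1
    · ring
  -- The inverse metric entry at `L = 0` is negative, which turns the minus sign of the last
  -- Christoffel term into a plus.
  have a3 : (1 / 2 : ℝ) * (sgn L * Real.exp (-(2 * γ L (x 0))) *
      (if L = 0 ∧ M = N then 2 * γ1 M (x 0) * (sgn M * Real.exp (2 * γ M (x 0))) else 0)) =
      -(if L = 0 ∧ M = N then γ1 M (x 0) * sgn M * Real.exp (2 * γ M (x 0) - 2 * γ 0 (x 0))
          else 0) := by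
    split_ifs with h
    · obtain ⟨rfl, -⟩ := h
      rw [sub_eq_add_neg, Real.exp_add, sgn_zero]
      ring
    · ring
  rw [mul_sub, mul_add, mul_sub, mul_add, a1, a2, a3]
  ring

theorem sum_fin16 (f : Fin 16 → ℝ) : ∑ μ, f μ = f 0 + ∑ i : Fin 15, f i.succ :=
  Fin.sum_univ_succ f

theorem pd_christoffel_timeMetric (hJ : IsOpen J)
    (h1 : ∀ μ, ∀ t ∈ J, HasDerivAt (γ μ) (γ1 μ t) t)
    (h2 : ∀ μ, ∀ t ∈ J, HasDerivAt (γ1 μ) (γ2 μ t) t) {x : Pt} (hx : x ∈ region J)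
    (K L M N : Fin 16) :
    pd K (christoffel (timeMetric γ) L M N) x = if K = 0 then
      (if M = 0 ∧ L = N then γ2 L (x 0) else 0) + (if N = 0 ∧ L = M then γ2 L (x 0) else 0)
      + (if L = 0 ∧ M = N then (γ2 M (x 0) + 2 * γ1 M (x 0) * (γ1 M (x 0) - γ1 0 (x 0))) * sgn M *
          Real.exp (2 * γ M (x 0) - 2 * γ 0 (x 0)) else 0) else 0 := by
  have hite : ∀ (p : Prop) [Decidable p] {u : ℝ → ℝ} {u' t : ℝ}, HasDerivAt u u' t →
      HasDerivAt (fun s => if p then u s else 0) (if p then u' else 0) t := by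
    intro p _ u u' t h
    split_ifs
    · exact h
    · exact hasDerivAt_const _ _
  refine pd_time_of_eqOn hJ hx (v := fun t =>
    (if M = 0 ∧ L = N then γ1 L t else 0) + (if N = 0 ∧ L = M then γ1 L t else 0)
      + (if L = 0 ∧ M = N then γ1 M t * sgn M * Real.exp (2 * γ M t - 2 * γ 0 t) else 0))
    (fun y hy => christoffel_timeMetric h1 hy L M N) ?_ K
  refine ((hite _ (h2 L _ hx)).add (hite _ (h2 L _ hx))).add (hite _ ?_)
  have := ((h2 M _ hx).mul_const (sgn M)).fun_mul
    ((((h1 M _ hx).const_mul 2).fun_sub ((h1 0 _ hx).const_mul 2)).exp)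
  refine this.congr_deriv ?_
  ring

/-- The Ricci tensor in the harmonic gauge `γ⁰ = ∑ γⁱ` (up to a constant). -/
theorem ricci_timeMetric (hJ : IsOpen J)
    (h1 : ∀ μ, ∀ t ∈ J, HasDerivAt (γ μ) (γ1 μ t) t)
    (h2 : ∀ μ, ∀ t ∈ J, HasDerivAt (γ1 μ) (γ2 μ t) t)
    (g1 : ∀ t ∈ J, γ1 0 t = ∑ i : Fin 15, γ1 i.succ t)
    (g2 : ∀ t ∈ J, γ2 0 t = ∑ i : Fin 15, γ2 i.succ t) {x : Pt} (hx : x ∈ region J)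
    (M N : Fin 16) :
    ricci (timeMetric γ) M N x = if M = N then
      (if M = 0 then -γ2 0 (x 0) + γ1 0 (x 0) ^ 2 - ∑ i : Fin 15, γ1 i.succ (x 0) ^ 2
        else γ2 M (x 0) * Real.exp (2 * γ M (x 0) - 2 * γ 0 (x 0))) else 0 := by
  -- The general `R_ii` contains the first-order term `γ̇ⁱ (∑ γ̇ʲ - γ̇⁰)`; the gauge condition
  -- removes it.
  have k1 := g1 _ hx
  have k2 := g2 _ hx
  simp only [ricci, sum_fin16, pd_christoffel_timeMetric hJ h1 h2 hx, christoffel_timeMetric h1 hx]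
  refine Fin.cases ?_ (fun i => ?_) M <;> refine Fin.cases ?_ (fun j => ?_) N
  · simp [Finset.sum_add_distrib, ← Finset.sum_mul, sq, Fin.succ_ne_zero, ← k1, ← k2]
    ring
  · simp [Fin.succ_ne_zero, (Fin.succ_ne_zero _).symm]
  · simp [Fin.succ_ne_zero, (Fin.succ_ne_zero _).symm]
  · by_cases hij : i = j
    · subst hij
      simp [Fin.succ_ne_zero, (Fin.succ_ne_zero _).symm, ← Finset.sum_mul, ← k1]
      ring
    · simp [Fin.succ_ne_zero, (Fin.succ_ne_zero _).symm, hij, Ne.symm hij]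

theorem scalarCurv_timeMetric (hJ : IsOpen J)
    (h1 : ∀ μ, ∀ t ∈ J, HasDerivAt (γ μ) (γ1 μ t) t)
    (h2 : ∀ μ, ∀ t ∈ J, HasDerivAt (γ1 μ) (γ2 μ t) t)
    (g1 : ∀ t ∈ J, γ1 0 t = ∑ i : Fin 15, γ1 i.succ t)
    (g2 : ∀ t ∈ J, γ2 0 t = ∑ i : Fin 15, γ2 i.succ t) {x : Pt} (hx : x ∈ region J) :
    scalarCurv (timeMetric γ) x = Real.exp (-(2 * γ 0 (x 0))) *
      (2 * γ2 0 (x 0) + ∑ i : Fin 15, γ1 i.succ (x 0) ^ 2 - γ1 0 (x 0) ^ 2) := by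
  have key : ∀ i : Fin 15, Real.exp (-(2 * γ i.succ (x 0))) * (γ2 i.succ (x 0) *
      Real.exp (2 * γ i.succ (x 0) - 2 * γ 0 (x 0))) =
      γ2 i.succ (x 0) * Real.exp (-(2 * γ 0 (x 0))) := fun i => by
    rw [mul_left_comm, ← Real.exp_add]; congr 2; ring
  have e : ∀ M, ∑ N, (timeMetric γ x)⁻¹ M N * ricci (timeMetric γ) M N x =
      (sgn M * Real.exp (-(2 * γ M (x 0)))) * ricci (timeMetric γ) M M x := fun M => by
    rw [timeMetric_inv, Finset.sum_eq_single M
      (fun K _ hK => by rw [Matrix.diagonal_apply_ne _ (Ne.symm hK), zero_mul])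
      (fun h => absurd (Finset.mem_univ _) h), Matrix.diagonal_apply_eq]
  rw [scalarCurv, Finset.sum_congr rfl fun M _ => e M]
  simp only [ricci_timeMetric hJ h1 h2 g1 g2 hx, sum_fin16, if_true,
    Fin.succ_ne_zero, if_false, sgn_zero, sgn_succ, one_mul, key, ← Finset.sum_mul, ← g2 _ hx]
  ring

theorem einstein_timeMetric (hJ : IsOpen J)
    (h1 : ∀ μ, ∀ t ∈ J, HasDerivAt (γ μ) (γ1 μ t) t)
    (h2 : ∀ μ, ∀ t ∈ J, HasDerivAt (γ1 μ) (γ2 μ t) t)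
    (g1 : ∀ t ∈ J, γ1 0 t = ∑ i : Fin 15, γ1 i.succ t)
    (g2 : ∀ t ∈ J, γ2 0 t = ∑ i : Fin 15, γ2 i.succ t) {x : Pt} (hx : x ∈ region J)
    (M N : Fin 16) :
    ricci (timeMetric γ) M N x - (1 / 2) * timeMetric γ x M N * scalarCurv (timeMetric γ) x =
      if M = N then sgn M * Real.exp (2 * γ M (x 0) - 2 * γ 0 (x 0)) *
        ((if M = 0 then ∑ i : Fin 15, γ1 i.succ (x 0) ^ 2 - γ1 0 (x 0) ^ 2
          else γ2 M (x 0) - γ2 0 (x 0)) - (1 / 2) *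
          (∑ i : Fin 15, γ1 i.succ (x 0) ^ 2 - γ1 0 (x 0) ^ 2)) else 0 := by
  rw [ricci_timeMetric hJ h1 h2 g1 g2 hx, scalarCurv_timeMetric hJ h1 h2 g1 g2 hx]
  by_cases hMN : M = N
  · subst hMN
    have e : Real.exp (2 * γ M (x 0)) * Real.exp (-(2 * γ 0 (x 0))) =
        Real.exp (2 * γ M (x 0) - 2 * γ 0 (x 0)) := by rw [← Real.exp_add, sub_eq_add_neg]
    rw [timeMetric, Matrix.diagonal_apply_eq, if_pos rfl, if_pos rfl, ← e]
    by_cases hM : M = 0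
    · subst hM
      rw [if_pos rfl, if_pos rfl, e, sub_self, Real.exp_zero, sgn_zero]
      have : Real.exp (2 * γ 0 (x 0)) * Real.exp (-(2 * γ 0 (x 0))) = 1 := by
        rw [← Real.exp_add]; simp
      linear_combination (1 / 2) * (2 * γ2 0 (x 0) + ∑ i : Fin 15, γ1 i.succ (x 0) ^ 2
        - γ1 0 (x 0) ^ 2) * this
    · rw [if_neg hM, if_neg hM, sgn, if_neg hM, e, ← e]
      ring
  · rw [if_neg hMN, if_neg hMN, timeMetric, Matrix.diagonal_apply_ne _ hMN]
    ring

theorem gradInner_time (hJ : IsOpen J) {u : Pt → ℝ} {v : ℝ → ℝ} {v' : ℝ} {x : Pt}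
    (hx : x ∈ region J) (hu : ∀ y ∈ region J, u y = v (y 0)) (h : HasDerivAt v v' (x 0)) :
    gradInner (timeMetric γ) u u x = -Real.exp (-(2 * γ 0 (x 0))) * v' ^ 2 := by
  simp only [gradInner, pd_time_of_eqOn hJ hx hu h, timeMetric_inv]
  rw [Finset.sum_eq_single 0 (fun M _ hM => by simp [hM]) (fun h => absurd (Finset.mem_univ _) h),
    Finset.sum_eq_single 0 (fun M _ hM => by simp [hM]) (fun h => absurd (Finset.mem_univ _) h)]
  simp
  ring

/-- The Laplace operator in the harmonic gauge. -/
theorem laplaceBeltrami_time (hJ : IsOpen J) {k : ℝ}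
    (g0 : ∀ t ∈ J, γ 0 t = ∑ i : Fin 15, γ i.succ t + k) {u : Pt → ℝ}
    {v v1 : ℝ → ℝ} {v2 : ℝ} {x : Pt} (hx : x ∈ region J) (hu : ∀ y ∈ region J, u y = v (y 0))
    (h : ∀ t ∈ J, HasDerivAt v (v1 t) t) (h' : HasDerivAt v1 v2 (x 0)) :
    laplaceBeltrami (timeMetric γ) u x = -Real.exp (-(2 * γ 0 (x 0))) * v2 := by
  -- In this gauge `√|g|` is `e^{2γ⁰}` up to a constant, so it cancels `g⁰⁰` and no first-order term
  -- survives.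
  have vol : ∀ y ∈ region J,
      volDensity (timeMetric γ) y = Real.exp (-k) * Real.exp (2 * γ 0 (y 0)) := by
    intro y hy
    rw [volDensity_timeMetric, sum_fin16, ← Real.exp_add]
    congr 1
    linear_combination -g0 _ hy
  have inner : ∀ M, ∀ y ∈ region J, volDensity (timeMetric γ) y *
      ∑ N, (timeMetric γ y)⁻¹ M N * pd N u y =
      (fun t => if M = 0 then -Real.exp (-k) * v1 t else 0) (y 0) := by
    intro M y hy
    rw [vol y hy]
    simp only [timeMetric_inv, pd_time_of_eqOn hJ hy hu (h _ hy)]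
    rw [Finset.sum_eq_single 0 (fun M _ hM => by simp [hM]) (fun h => absurd (Finset.mem_univ _) h)]
    by_cases hM : M = 0
    · subst hM
      have : Real.exp (2 * γ 0 (y 0)) * Real.exp (-(2 * γ 0 (y 0))) = 1 := by
        rw [← Real.exp_add]; simp
      simp only [if_true, Matrix.diagonal_apply_eq, sgn_zero]
      linear_combination -Real.exp (-k) * v1 (y 0) * this
    · simp [hM]
  have hd : ∀ M : Fin 16, HasDerivAt (fun t => if M = 0 then -Real.exp (-k) * v1 t else 0)
      (if M = 0 then -Real.exp (-k) * v2 else 0) (x 0) := by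
    intro M
    split_ifs
    · exact h'.const_mul _
    · exact hasDerivAt_const _ _
  rw [laplaceBeltrami, vol x hx, Finset.sum_congr rfl fun M _ =>
    pd_time_of_eqOn hJ hx (inner M) (hd M) M,
    Finset.sum_eq_single 0 (fun M _ hM => by simp [hM]) (fun h => absurd (Finset.mem_univ _) h),
    if_pos rfl, if_pos rfl, mul_inv, Real.exp_neg (2 * _)]
  field_simp

end curvature

/-! ### Components of elementary forms -/

/-- The component `(dx^T)(∂_{K 0}, …, ∂_{K (a-1)})`. -/
noncomputable def dxComp (a : ℕ) (T : Finset (Fin 16)) (K : Fin a → Fin 16) : ℝ :=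
  dxSet a T fun i => Pi.single (K i) 1

theorem dxComp_eq_det {a : ℕ} {T : Finset (Fin 16)} (hT : T.card = a) (K : Fin a → Fin 16) :
    dxComp a T K = Matrix.det (Matrix.of fun i j => if T.orderEmbOfFin hT j = K i then (1 : ℝ) else 0) := by
  rw [dxComp, dxSet, dif_pos hT, dxTuple_apply]
  congr 1
  ext i j
  simp [Pi.single_apply]

/-- The component is the determinant of a 0-1 matrix. This is a permutation matrix when `K`
enumerates `T`; otherwise it has a zero row or two equal rows. -/
theorem dxComp_sq {a : ℕ} {T : Finset (Fin 16)} (hT : T.card = a) (K : Fin a → Fin 16)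
    [Decidable (Function.Injective K ∧ ∀ i, K i ∈ T)] :
    dxComp a T K * dxComp a T K = if Function.Injective K ∧ ∀ i, K i ∈ T then 1 else 0 := by
  rw [dxComp_eq_det hT]
  split_ifs with h
  · obtain ⟨hinj, hmem⟩ := h
    have hex : ∀ i, ∃ j, T.orderEmbOfFin hT j = K i := fun i => by
      have : K i ∈ Set.range (T.orderEmbOfFin hT) := by
        rw [Finset.range_orderEmbOfFin]; exact hmem i
      exact this
    choose f hf using hex
    have hfinj : Function.Injective f := fun i j hij => hinj (by rw [← hf, ← hf, hij])
    let σ : Equiv.Perm (Fin a) := Equiv.ofBijective f (Finite.injective_iff_bijective.mp hfinj)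
    have hM : (Matrix.of fun i j => if T.orderEmbOfFin hT j = K i then (1 : ℝ) else 0) =
        (1 : Matrix (Fin a) (Fin a) ℝ).submatrix σ id := by
      ext i j
      simp only [Matrix.of_apply, Matrix.submatrix_apply, Matrix.one_apply, id, ← hf i,
        EmbeddingLike.apply_eq_iff_eq]
      exact if_congr ⟨fun h => h.symm, fun h => h.symm⟩ rfl rfl
    rw [hM, Matrix.det_permute, Matrix.det_one, mul_one]
    rcases Int.units_eq_one_or (Equiv.Perm.sign σ) with h | h <;> simp [h]
  · rw [mul_self_eq_zero]
    by_cases hinj : Function.Injective K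
    · have : ∃ i, K i ∉ T := by by_contra! hc; exact h ⟨hinj, hc⟩
      obtain ⟨i, hi⟩ := this
      refine Matrix.det_eq_zero_of_row_eq_zero i fun j => ?_
      rw [Matrix.of_apply, if_neg]
      intro he
      exact hi (he ▸ Finset.orderEmbOfFin_mem T hT j)
    · simp only [Function.Injective, not_forall] at hinj
      obtain ⟨i, j, hij, hne⟩ := hinj
      exact Matrix.det_zero_of_row_eq hne (by funext l; simp [hij])

theorem dxComp_ne_zero {a : ℕ} {T : Finset (Fin 16)} (hT : T.card = a) {K : Fin a → Fin 16}
    (h : dxComp a T K ≠ 0) : Function.Injective K ∧ Finset.univ.image K = T := by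
  classical
  have h2 := dxComp_sq hT K
  split_ifs at h2 with hc
  · refine ⟨hc.1, Finset.eq_of_subset_of_card_le (fun m hm => ?_) ?_⟩
    · obtain ⟨i, -, rfl⟩ := Finset.mem_image.mp hm
      exact hc.2 i
    · rw [hT, Finset.card_image_of_injective _ hc.1, Finset.card_univ, Fintype.card_fin]
  · exact absurd (mul_self_eq_zero.mp h2) h

theorem card_injective_into {a : ℕ} {T : Finset (Fin 16)} (hT : T.card = a)
    [DecidablePred fun K : Fin a → Fin 16 => Function.Injective K ∧ ∀ i, K i ∈ T] :
    (Finset.univ.filter fun K : Fin a → Fin 16 =>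
      Function.Injective K ∧ ∀ i, K i ∈ T).card = a ! := by
  have e : {K : Fin a → Fin 16 // Function.Injective K ∧ ∀ i, K i ∈ T} ≃ (Fin a ↪ T) :=
    { toFun := fun K => ⟨fun i => ⟨K.1 i, K.2.2 i⟩, fun i j hij => K.2.1 (congrArg Subtype.val hij)⟩
      invFun := fun f => ⟨fun i => (f i : Fin 16),
        fun i j hij => f.injective (Subtype.ext hij), fun i => (f i).2⟩
      left_inv := fun K => rfl
      right_inv := fun f => rfl }
  rw [← Fintype.card_subtype, Fintype.card_congr e, Fintype.card_embedding_eq, Fintype.card_coe, hT,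
    Fintype.card_fin, Nat.descFactorial_self]

/-- Only the `a!` enumerations of `T` contribute, each with the same product. -/
theorem sum_dxComp_sq {a : ℕ} {T : Finset (Fin 16)} (hT : T.card = a) (h : Fin 16 → ℝ) :
    ∑ K : Fin a → Fin 16, dxComp a T K * dxComp a T K * ∏ i, h (K i) = a ! * ∏ μ ∈ T, h μ := by
  classical
  have : ∀ K : Fin a → Fin 16, dxComp a T K * dxComp a T K * ∏ i, h (K i) =
      if Function.Injective K ∧ ∀ i, K i ∈ T then ∏ μ ∈ T, h μ else 0 := by
    intro K
    have h2 := dxComp_sq hT K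
    split_ifs at h2 ⊢ with hc
    · have h3 := dxComp_ne_zero hT (K := K) (fun h0 => by simp [h0] at h2)
      rw [h2, one_mul, ← h3.2, Finset.prod_image (fun i _ j _ hij => h3.1 hij)]
    · rw [h2, zero_mul]
  rw [Finset.sum_congr rfl fun K _ => this K, ← Finset.sum_filter, Finset.sum_const,
    card_injective_into hT, nsmul_eq_mul]

theorem dxComp_mul_of_ne {a : ℕ} {T T' : Finset (Fin 16)} (hT : T.card = a) (hT' : T'.card = a)
    (hne : T ≠ T') (K : Fin a → Fin 16) : dxComp a T K * dxComp a T' K = 0 := by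
  by_contra h
  obtain ⟨h1, h2⟩ := mul_ne_zero_iff.mp h
  exact hne ((dxComp_ne_zero hT h1).2.symm.trans (dxComp_ne_zero hT' h2).2)

theorem image_cons {n : ℕ} (M : Fin 16) (K : Fin n → Fin 16) :
    Finset.univ.image (Fin.cons M K : Fin (n + 1) → Fin 16) = insert M (Finset.univ.image K) := by
  ext m
  simp [Fin.exists_fin_succ, eq_comm]

/-- With the first index fixed at `M ∈ T`, the others enumerate `T \ {M}`. The product over that set
is the one over `T` divided by `h M`. -/
theorem sum_dxComp_cons_sq {n : ℕ} {T : Finset (Fin 16)} (hT : T.card = n + 1) {h : Fin 16 → ℝ}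
    (hh : ∀ μ, h μ ≠ 0) (M : Fin 16) :
    ∑ K : Fin n → Fin 16, dxComp (n + 1) T (Fin.cons M K) * dxComp (n + 1) T (Fin.cons M K)
      * ∏ i, h (K i) = n ! * if M ∈ T then (h M)⁻¹ * ∏ μ ∈ T, h μ else 0 := by
  classical
  by_cases hM : M ∈ T
  · have hcard : (T.erase M).card = n := by rw [Finset.card_erase_of_mem hM, hT]; rfl
    rw [if_pos hM, ← Finset.mul_prod_erase T h hM, inv_mul_cancel_left₀ (hh M),
      ← sum_dxComp_sq hcard h]
    refine Finset.sum_congr rfl fun K _ => ?_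
    rw [dxComp_sq hT, dxComp_sq hcard]
    congr 1
    refine if_congr ?_ rfl rfl
    rw [Fin.cons_injective_iff]
    simp only [Fin.forall_fin_succ, Fin.cons_zero, Fin.cons_succ, Finset.mem_erase, Set.mem_range,
      not_exists]
    exact ⟨fun ⟨⟨h1, h2⟩, _, h4⟩ => ⟨h2, fun i => ⟨h1 i, h4 i⟩⟩,
      fun ⟨h2, h3⟩ => ⟨⟨fun i => (h3 i).1, h2⟩, hM, fun i => (h3 i).2⟩⟩
  · rw [if_neg hM, mul_zero]
    refine Finset.sum_eq_zero fun K _ => ?_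
    rw [dxComp_sq hT, if_neg, zero_mul]
    exact fun hc => hM (by simpa using hc.2 0)

/-- If both factors were nonzero, `T` and `T'` would share the image of `K`, so at most `M` could
lie in `T` and not in `T'`. This removes the cross terms between different branes in the stress
tensor. -/
theorem dxComp_cons_mul_of_ne {n : ℕ} {T T' : Finset (Fin 16)} (hT : T.card = n + 1)
    (hT' : T'.card = n + 1) (hne : 2 ≤ (T \ T').card) (M N : Fin 16) (K : Fin n → Fin 16) :
    dxComp (n + 1) T (Fin.cons M K) * dxComp (n + 1) T' (Fin.cons N K) = 0 := by
  by_contra h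
  obtain ⟨h1, h2⟩ := mul_ne_zero_iff.mp h
  have e1 := (dxComp_ne_zero hT h1).2
  have e2 := (dxComp_ne_zero hT' h2).2
  rw [image_cons] at e1 e2
  have : T \ T' ⊆ {M} := by
    intro m hm
    rw [Finset.mem_sdiff, ← e1, ← e2, Finset.mem_insert, Finset.mem_insert, not_or] at hm
    rw [Finset.mem_singleton]
    tauto
  have := Finset.card_le_card this
  rw [Finset.card_singleton] at this
  omega

/-- If both factors were nonzero, `{M} ∪ im K` and `{N} ∪ im K` would both be `T`. Then `M ∈ im K`,
against injectivity. This makes the contribution of a single brane to the stress tensor diagonal. -/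
theorem dxComp_cons_mul_cons_of_ne {n : ℕ} {T : Finset (Fin 16)} (hT : T.card = n + 1)
    {M N : Fin 16} (hne : M ≠ N) (K : Fin n → Fin 16) :
    dxComp (n + 1) T (Fin.cons M K) * dxComp (n + 1) T (Fin.cons N K) = 0 := by
  by_contra h
  obtain ⟨h1, h2⟩ := mul_ne_zero_iff.mp h
  obtain ⟨i1, e1⟩ := dxComp_ne_zero hT h1
  have e2 := (dxComp_ne_zero hT h2).2
  rw [image_cons] at e1 e2
  have hM : M ∈ insert N (Finset.univ.image K) := by rw [e2, ← e1]; exact Finset.mem_insert_self _ _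
  rcases Finset.mem_insert.mp hM with h | h
  · exact hne h
  · obtain ⟨i, -, hi⟩ := Finset.mem_image.mp h
    have : (Fin.cons M K : Fin (n + 1) → Fin 16) i.succ = (Fin.cons M K : Fin (n + 1) → Fin 16) 0 := by
      simpa using hi
    exact Fin.succ_ne_zero i (i1 this)

/-! ### Quadratic expressions in sums of elementary forms -/

section forms

variable {g : MetricField} {h : Fin 16 → ℝ} {x : Pt} {S : Finset (Fin 10)} {k : Fin 10 → ℝ}
  {T : Fin 10 → Finset (Fin 16)}

theorem compUp_diagonal (hg : (g x)⁻¹ = Matrix.diagonal h) {a : ℕ} (F : DForm a)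
    (K : Fin a → Fin 16) : compUp g F x K = (∏ i, h (K i)) * formComp F x K := by
  rw [compUp, Finset.sum_eq_single K]
  · simp [hg]
  · intro L _ hL
    obtain ⟨i, hi⟩ := Function.ne_iff.mp hL
    rw [Finset.prod_eq_zero (Finset.mem_univ i), zero_mul]
    rw [hg, Matrix.diagonal_apply_ne _ (Ne.symm hi)]
  · exact fun h => absurd (Finset.mem_univ _) h

theorem formComp_sum {a : ℕ} {F : DForm a} (hF : F x = ∑ s ∈ S, k s • dxSet a (T s))
    (K : Fin a → Fin 16) : formComp F x K = ∑ s ∈ S, k s * dxComp a (T s) K := by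
  rw [formComp, hF, ContinuousAlternatingMap.sum_apply]
  rfl

theorem formSq_sum (hg : (g x)⁻¹ = Matrix.diagonal h) {a : ℕ} {F : DForm a}
    (hF : F x = ∑ s ∈ S, k s • dxSet a (T s)) (hT : ∀ s ∈ S, (T s).card = a)
    (hne : ∀ s ∈ S, ∀ s' ∈ S, s ≠ s' → T s ≠ T s') :
    formSq g F x = a ! * ∑ s ∈ S, k s ^ 2 * ∏ μ ∈ T s, h μ := by
  have e : ∀ K : Fin a → Fin 16, formComp F x K * compUp g F x K =
      ∑ s ∈ S, k s ^ 2 * (dxComp a (T s) K * dxComp a (T s) K * ∏ i, h (K i)) := by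
    intro K
    rw [compUp_diagonal hg, formComp_sum hF, mul_left_comm, Finset.sum_mul_sum, Finset.mul_sum]
    refine Finset.sum_congr rfl fun s hs => ?_
    rw [Finset.sum_eq_single s]
    · ring
    · intro s' hs' hss
      have := dxComp_mul_of_ne (hT s hs) (hT s' hs') (hne s hs s' hs' (Ne.symm hss)) K
      linear_combination k s * k s' * this
    · exact fun h => absurd hs h
  rw [formSq, Finset.sum_congr rfl fun K _ => e K, Finset.sum_comm, Finset.mul_sum]
  refine Finset.sum_congr rfl fun s hs => ?_
  rw [← Finset.mul_sum, sum_dxComp_sq (hT s hs)]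
  ring

/-- Distinct supports suffice for the full square, but here one index stays free on each side, hence
the stronger hypothesis of two differing indices. -/
theorem formContract_sum (hg : (g x)⁻¹ = Matrix.diagonal h) (hh : ∀ μ, h μ ≠ 0) {n : ℕ}
    {F : DForm (n + 1)} (hF : F x = ∑ s ∈ S, k s • dxSet (n + 1) (T s))
    (hT : ∀ s ∈ S, (T s).card = n + 1)
    (hne : ∀ s ∈ S, ∀ s' ∈ S, s ≠ s' → 2 ≤ (T s \ T s').card) (M N : Fin 16) :
    formContract g F M N x = if M = N then n ! * ∑ s ∈ S, k s ^ 2 *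
      (if M ∈ T s then (h M)⁻¹ * ∏ μ ∈ T s, h μ else 0) else 0 := by
  have e : ∀ K : Fin n → Fin 16, ∑ L : Fin n → Fin 16, formComp F x (Fin.cons M K) *
      formComp F x (Fin.cons N L) * ∏ i, (g x)⁻¹ (K i) (L i) =
      ∑ s ∈ S, k s ^ 2 * (dxComp (n + 1) (T s) (Fin.cons M K) *
        dxComp (n + 1) (T s) (Fin.cons N K) * ∏ i, h (K i)) := by
    intro K
    rw [Finset.sum_eq_single K]
    · rw [formComp_sum hF, formComp_sum hF, Finset.sum_mul_sum, Finset.sum_mul]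
      refine Finset.sum_congr rfl fun s hs => ?_
      rw [Finset.sum_eq_single s]
      · simp only [hg, Matrix.diagonal_apply_eq]
        ring
      · intro s' hs' hss
        have := dxComp_cons_mul_of_ne (hT s hs) (hT s' hs') (hne s hs s' hs' (Ne.symm hss)) M N K
        linear_combination k s * k s' * this
      · exact fun h => absurd hs h
    · intro L _ hL
      obtain ⟨i, hi⟩ := Function.ne_iff.mp hL
      rw [Finset.prod_eq_zero (Finset.mem_univ i), mul_zero]
      rw [hg, Matrix.diagonal_apply_ne _ (Ne.symm hi)]
    · exact fun h => absurd (Finset.mem_univ _) h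
  rw [formContract, Finset.sum_congr rfl fun K _ => e K, Finset.sum_comm]
  split_ifs with hMN
  · subst hMN
    rw [Finset.mul_sum]
    refine Finset.sum_congr rfl fun s hs => ?_
    rw [← Finset.mul_sum, sum_dxComp_cons_sq (hT s hs) hh]
    ring
  · refine Finset.sum_eq_zero fun s hs => ?_
    rw [← Finset.mul_sum, Finset.sum_eq_zero, mul_zero]
    intro K _
    rw [dxComp_cons_mul_cons_of_ne (hT s hs) hMN, zero_mul]

end forms

/-! ### Closedness -/

/-- The derivative is `k' dt ∧ dx^T`, which vanishes because `dt` already occurs in `dx^T`. -/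
theorem extDeriv_time_smul_dxSet {a : ℕ} {T : Finset (Fin 16)} (h0 : 0 ∈ T) {k : ℝ → ℝ} {x : Pt}
    (hk : DifferentiableAt ℝ k (x 0)) :
    extDeriv (fun y : Pt => k (y 0) • dxSet a T) x = 0 := by
  have h1 : HasFDerivAt (fun y : Pt => y 0) (ContinuousLinearMap.proj (R := ℝ) (0 : Fin 16)) x :=
    hasFDerivAt_apply 0 x
  have h3 := (hk.hasDerivAt.comp_hasFDerivAt x h1).smul_const (dxSet a T)
  have h4 : HasFDerivAt (fun y : Pt => k (y 0) • dxSet a T) _ x := h3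
  ext v
  have h5 : ∀ w : Fin a → Pt, HasFDerivAt (fun y : Pt => (k (y 0) • dxSet a T) w) _ x := fun w =>
    (hk.hasDerivAt.comp_hasFDerivAt x h1).smul_const (dxSet a T w)
  simp only [extDeriv_apply h4.differentiableAt, (h5 _).fderiv]
  by_cases hT : T.card = a
  · have hpos : 0 < a := hT ▸ Finset.card_pos.mpr ⟨0, h0⟩
    have hz : T.orderEmbOfFin hT ⟨0, hpos⟩ = 0 := by
      rw [Finset.orderEmbOfFin_zero hT hpos]
      exact le_antisymm (Finset.min'_le _ _ h0) (Fin.zero_le _)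
    -- Expanding the determinant of `A` along its first column gives the alternating sum defining
    -- `dt ∧ dx^T`. The coordinate `0`, being the least element of `T`, is repeated in the second
    -- column.
    let A : Matrix (Fin (a + 1)) (Fin (a + 1)) ℝ :=
      Matrix.of fun i j => (Fin.cons (v i 0) (fun l => v i (T.orderEmbOfFin hT l)) : Fin (a + 1) → ℝ) j
    have hA : A.det = 0 := by
      refine Matrix.det_zero_of_column_eq (i := 0) (j := Fin.succ ⟨0, hpos⟩)
        (Fin.succ_ne_zero _).symm fun i => ?_
      simp only [A, Matrix.of_apply, Fin.cons_zero, Fin.cons_succ, hz]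
    rw [Matrix.det_succ_column_zero] at hA
    have := congrArg (deriv k (x 0) * ·) hA
    simp only [mul_zero, Finset.mul_sum] at this
    refine Eq.trans ?_ this
    refine Finset.sum_congr rfl fun i _ => ?_
    simp only [dxSet, dif_pos hT]
    simp only [ContinuousLinearMap.smulRight_apply, _root_.smul_apply,
      ContinuousLinearMap.proj_apply, dxTuple_apply, smul_eq_mul,
      zsmul_eq_mul]
    have : (A.submatrix i.succAbove Fin.succ) =
        Matrix.of fun i_1 j => i.removeNth v i_1 (T.orderEmbOfFin hT j) := by
      ext p q
      simp [A, Fin.removeNth]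
    rw [this]
    simp [A]
    ring
  · simp [dxSet, hT]

/-! ### The brane configuration -/

theorem chi_eq (s : Fin 10) : chi s = ((if s = 0 then -1 else 1 : ℤ) : ℝ) := by
  fin_cases s <;> simp [chi]

theorem zero_notMem_braneSet : ∀ s, (0 : Fin 16) ∉ braneSet s := by decide

theorem colour_mem_Icc : ∀ s, colour s ∈ Finset.Icc 4 9 := by decide

theorem e10_comm (s s' : Fin 10) : e10 s s' = e10 s' s := by
  simp only [e10, Matrix.of_apply, eq_comm (a := s), Sym2.eq_swap (a := s)]

/-- The intersection rules cleared of the denominator `14`, with the Gram matrix of the coupling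
vectors inserted, so that they become a decidable statement about integers. -/
theorem card_braneSet_inter : ∀ s s',
    14 * ((braneSet s ∩ braneSet s').card : ℤ) = 14 * e10 s s'
      + (braneSet s).card * (braneSet s').card
      + (if s = 0 then -1 else 1) * (if s' = 0 then -1 else 1) *
        (14 * (min (colour s : ℤ) (colour s') - 3) - (colour s - 1) * (colour s' - 1)) := by
  decide

theorem two_le_card_formSupport_sdiff : ∀ s s', colour s = colour s' → s ≠ s' →
    2 ≤ (formSupport s \ formSupport s').card := by decide

theorem card_formSupport : ∀ s, (formSupport s).card = colour s := by decide

theorem sum_bNum : ∑ s, bNum s = -2480 := by decide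

theorem e10_mul_bNum : ∀ s, ∑ s', e10 s s' * bNum s' = 2 := by decide

theorem bNum_neg : ∀ s, bNum s < 0 := by decide

/-! ### Inverting the Cartan matrix -/

/-- The inverse of the Cartan matrix of `E₁₀`. -/
def e10Inv : Matrix (Fin 10) (Fin 10) ℤ :=
  !![-10, -3, -6, -9, -12, -15, -18, -21, -14, -7;
    -3, 0, -1, -2, -3, -4, -5, -6, -4, -2;
    -6, -1, -2, -4, -6, -8, -10, -12, -8, -4;
    -9, -2, -4, -6, -9, -12, -15, -18, -12, -6;
    -12, -3, -6, -9, -12, -16, -20, -24, -16, -8;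
    -15, -4, -8, -12, -16, -20, -25, -30, -20, -10;
    -18, -5, -10, -15, -20, -25, -30, -36, -24, -12;
    -21, -6, -12, -18, -24, -30, -36, -42, -28, -14;
    -14, -4, -8, -12, -16, -20, -24, -28, -18, -9;
    -7, -2, -4, -6, -8, -10, -12, -14, -9, -4]

/-- Index `0` stands for node `10`, so that node owns the first row and column of the explicit
matrix. A one-sided inverse is enough to make the determinant a unit. -/
theorem e10_mul_e10Inv : e10 * e10Inv = 1 := by
  have h : ∀ s s' : Fin 10, ∑ k, e10 s k * e10Inv k s' = if s = s' then 1 else 0 := by decide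
  ext s s'
  rw [Matrix.mul_apply, h, Matrix.one_apply]

theorem isUnit_det_e10 : IsUnit (e10.map (Int.cast : ℤ → ℝ)).det := by
  refine Matrix.isUnit_det_of_right_inverse (B := e10Inv.map (Int.cast : ℤ → ℝ)) ?_
  have := congrArg (fun M : Matrix (Fin 10) (Fin 10) ℤ => M.map (Int.castRingHom ℝ)) e10_mul_e10Inv
  simp only [Matrix.map_mul, Matrix.map_one _ (map_zero _) (map_one _)] at this
  exact this

theorem bNum_eq (s : Fin 10) :
    (bNum s : ℝ) = 2 * ∑ s', (e10.map (Int.cast : ℤ → ℝ))⁻¹ s s' := by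
  have h : (e10.map (Int.cast : ℤ → ℝ)) *ᵥ (fun s => (bNum s : ℝ)) = fun _ => 2 := by
    funext s
    have := congrArg (Int.cast : ℤ → ℝ) (e10_mul_bNum s)
    push_cast at this
    exact this
  have h2 := congrArg (fun v => (e10.map (Int.cast : ℤ → ℝ))⁻¹ *ᵥ v) h
  simp only [Matrix.mulVec_mulVec, Matrix.nonsing_inv_mul _ isUnit_det_e10, Matrix.one_mulVec] at h2
  rw [congrFun h2 s, Matrix.mulVec, dotProduct, Finset.mul_sum]
  exact Finset.sum_congr rfl fun s' _ => mul_comm _ _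

theorem eq_of_e10_mulVec_eq {u v : Fin 10 → ℝ}
    (h : ∀ s, ∑ s', (e10 s s' : ℝ) * u s' = ∑ s', (e10 s s' : ℝ) * v s') : u = v :=
  Matrix.mulVec_injective_of_isUnit
    ((Matrix.isUnit_iff_isUnit_det _).mpr isUnit_det_e10) (funext h)

/-! ### The target-space metric and the brane products -/

/-- With `E` the all-ones matrix of size `15`, `E² = 15E` gives `(1 - E)(1 - E/14) = 1`. This is the
origin of the number `14 = D - 2`. -/
theorem targetMetric_mul :
    targetMetric * Matrix.fromBlocks (Matrix.of fun i j : Fin 15 => (if i = j then 1 else 0) - 1 / 14)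
      0 0 (-1 : Matrix (Fin 5) (Fin 5) ℝ) = 1 := by
  rw [targetMetric, Matrix.fromBlocks_multiply, ← Matrix.fromBlocks_one]
  congr 1
  · ext i j
    simp only [Matrix.mul_zero, add_zero, Matrix.mul_apply, Matrix.of_apply, sub_mul, mul_sub,
      Finset.sum_sub_distrib, Matrix.one_apply]
    simp
    ring
  · simp
  · simp
  · simp

theorem targetMetric_inv :
    targetMetric⁻¹ = Matrix.fromBlocks
      (Matrix.of fun i j : Fin 15 => (if i = j then 1 else 0) - 1 / 14) 0 0 (-1) :=
  Matrix.inv_eq_right_inv targetMetric_mul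

theorem targetMetric_isSymm : targetMetric.IsSymm := by
  refine Matrix.IsSymm.fromBlocks ?_ (by simp) ?_
  · ext i j
    simp [eq_comm]
  · simp [Matrix.IsSymm]

theorem sum_mem_braneSet (s : Fin 10) (w : Fin 16 → ℝ) :
    ∑ i : Fin 15, (if i.succ ∈ braneSet s then w i.succ else 0) = ∑ μ ∈ braneSet s, w μ := by
  have := Fin.sum_univ_succ (fun μ : Fin 16 => if μ ∈ braneSet s then w μ else 0)
  rw [if_neg (zero_notMem_braneSet s), zero_add] at this
  rw [← this, Finset.sum_ite_mem, Finset.univ_inter]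

/-- The vector dual to `U^s`. -/
noncomputable def braneDir (lam : ℕ → Fin 5 → ℝ) (s : Fin 10) : Fin 15 ⊕ Fin 5 → ℝ :=
  targetMetric⁻¹ *ᵥ braneVec lam s

/-- The raised components of `U^s` are the exponents with which `f_s⁻¹` enters the spatial scale
factors of the metric. -/
theorem braneDir_inl (lam : ℕ → Fin 5 → ℝ) (s : Fin 10) (i : Fin 15) :
    braneDir lam s (Sum.inl i) = (if i.succ ∈ braneSet s then 1 else 0) - dimI s / 14 := by
  have h := sum_mem_braneSet s (fun _ => 1)
  rw [Finset.sum_const, nsmul_eq_mul, mul_one] at h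
  rw [braneDir, targetMetric_inv, Matrix.fromBlocks_mulVec, Sum.elim_inl, dimI, ← h]
  simp only [braneVec, Sum.elim_comp_inl, Sum.elim_comp_inr, Matrix.zero_mulVec, add_zero]
  simp only [Matrix.mulVec, dotProduct, Matrix.of_apply, sub_mul, Finset.sum_sub_distrib,
    ← Finset.mul_sum, ite_mul, one_mul, zero_mul, Finset.sum_ite_eq, Finset.mem_univ, if_true]
  ring

theorem braneDir_inr (lam : ℕ → Fin 5 → ℝ) (s : Fin 10) (α : Fin 5) :
    braneDir lam s (Sum.inr α) = chi s * lam (colour s) α := by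
  rw [braneDir, targetMetric_inv, Matrix.fromBlocks_mulVec, Sum.elim_inr]
  simp [braneVec, Matrix.neg_mulVec]

/-- This makes the intersection rule for a pair of branes equivalent to `(U^s, U^{s'}) = A_{ss'}`.
-/
theorem braneProd_eq (lam : ℕ → Fin 5 → ℝ) (s s' : Fin 10) :
    braneProd lam s s' = ((braneSet s ∩ braneSet s').card : ℝ) - orthoIntersection lam s s' := by
  have h1 : ∑ i : Fin 15, (if i.succ ∈ braneSet s then (1 : ℝ) else 0) *
      ((if i.succ ∈ braneSet s' then 1 else 0) - dimI s' / 14) =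
      ((braneSet s ∩ braneSet s').card : ℝ) - dimI s * dimI s' / 14 := by
    have := sum_mem_braneSet s (fun μ => (if μ ∈ braneSet s' then 1 else 0) - dimI s' / 14)
    simp only [ite_mul, one_mul, zero_mul]
    rw [this, Finset.sum_sub_distrib, Finset.sum_const, nsmul_eq_mul, Finset.sum_ite_mem,
      Finset.sum_const, nsmul_eq_mul]
    simp only [dimI]
    ring
  have h2 : ∑ α, -chi s * lam (colour s) α * (chi s' * lam (colour s') α) =
      -(chi s * chi s' * (lam (colour s) ⬝ᵥ lam (colour s'))) := by
    rw [dotProduct, Finset.mul_sum, ← Finset.sum_neg_distrib]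
    exact Finset.sum_congr rfl fun α _ => by ring
  have : braneProd lam s s' = braneVec lam s ⬝ᵥ braneDir lam s' := rfl
  rw [this, dotProduct, Fintype.sum_sum_type]
  simp only [braneDir_inl, braneDir_inr, braneVec, Sum.elim_inl, Sum.elim_inr]
  rw [h1, h2, orthoIntersection]
  ring

theorem card_inter_eq {lam : ℕ → Fin 5 → ℝ} (hlam : IsB16Coupling lam) (s s' : Fin 10) :
    ((braneSet s ∩ braneSet s').card : ℝ) = orthoIntersection lam s s' + (e10 s s' : ℝ) := by
  have h := congrArg (Int.cast : ℤ → ℝ) (card_braneSet_inter s s')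
  rw [orthoIntersection, hlam.gram _ (colour_mem_Icc s) _ (colour_mem_Icc s'), chi_eq, chi_eq,
    dimI, dimI]
  push_cast at h ⊢
  linear_combination h / 14

theorem braneProd_eq_e10 {lam : ℕ → Fin 5 → ℝ} (hlam : IsB16Coupling lam) (s s' : Fin 10) :
    braneProd lam s s' = (e10 s s' : ℝ) := by
  rw [braneProd_eq, card_inter_eq hlam]
  ring

theorem e10_self (s : Fin 10) : e10 s s = 2 := by
  simp [e10]

/-! ### The exponents of the solution -/

/-- The coefficient of `q^s / 2` in the exponent of the scale factor `μ`. -/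
noncomputable def scaleWeight (s : Fin 10) (μ : Fin 16) : ℝ :=
  (if μ ∈ braneSet s then 1 else 0) - dimI s / 14

/-- `½ ∑ p_s w_s`: the affine combinations of the `q^s` entering the scale factors. -/
noncomputable def scaleSum (p : Fin 10 → ℝ) (μ : Fin 16) : ℝ :=
  ∑ s, p s / 2 * scaleWeight s μ

/-- The affine combinations of the `q^s` entering the scalar fields. -/
noncomputable def scalarSum (lam : ℕ → Fin 5 → ℝ) (p : Fin 10 → ℝ) (α : Fin 5) : ℝ :=
  ∑ s, p s / 2 * (chi s * lam (colour s) α)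

/-- `d - 15d/14 = -d/14`: each `q^s` separately respects the harmonic gauge. -/
theorem sum_scaleWeight (s : Fin 10) : ∑ i : Fin 15, scaleWeight s i.succ = scaleWeight s 0 := by
  have h := sum_mem_braneSet s (fun _ => 1)
  rw [Finset.sum_const, nsmul_eq_mul, mul_one] at h
  simp only [scaleWeight, Finset.sum_sub_distrib, h, zero_notMem_braneSet, if_false]
  simp [dimI]
  ring

theorem sum_scaleSum (p : Fin 10 → ℝ) : ∑ i : Fin 15, scaleSum p i.succ = scaleSum p 0 := by
  simp only [scaleSum]
  rw [Finset.sum_comm]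
  simp only [← Finset.mul_sum, sum_scaleWeight]

theorem sumElim_eq_sum_braneDir (lam : ℕ → Fin 5 → ℝ) (p : Fin 10 → ℝ) :
    Sum.elim (fun i : Fin 15 => scaleSum p i.succ) (scalarSum lam p) =
      ∑ s, (p s / 2) • braneDir lam s := by
  funext A
  rw [Finset.sum_apply]
  cases A with
  | inl i => simp [scaleSum, scaleWeight, braneDir_inl]
  | inr α => simp [scalarSum, braneDir_inr]

theorem braneVec_dotProduct_sum {lam : ℕ → Fin 5 → ℝ} (hlam : IsB16Coupling lam)
    (p : Fin 10 → ℝ) (s : Fin 10) :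
    braneVec lam s ⬝ᵥ ∑ s', (p s' / 2) • braneDir lam s' =
      (1 / 2) * ∑ s', (e10 s s' : ℝ) * p s' := by
  rw [dotProduct_sum, Finset.mul_sum]
  refine Finset.sum_congr rfl fun s' _ => ?_
  rw [dotProduct_smul, smul_eq_mul, ← braneProd_eq_e10 hlam, braneProd, braneDir]
  ring

theorem targetMetric_mulVec_braneDir (lam : ℕ → Fin 5 → ℝ) (s : Fin 10) :
    targetMetric *ᵥ braneDir lam s = braneVec lam s := by
  rw [braneDir, Matrix.mulVec_mulVec, targetMetric_inv, targetMetric_mul, Matrix.one_mulVec]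

theorem targetMetric_norm (v : Fin 15 → ℝ) (w : Fin 5 → ℝ) :
    Sum.elim v w ⬝ᵥ (targetMetric *ᵥ Sum.elim v w) =
      -∑ α, w α ^ 2 + ∑ i, v i ^ 2 - (∑ i, v i) ^ 2 := by
  have h1 : (Matrix.of fun i j : Fin 15 => (if i = j then (1 : ℝ) else 0) - 1) *ᵥ v =
      fun i => v i - ∑ j, v j := by
    funext i
    simp [Matrix.mulVec, dotProduct, sub_mul, Finset.sum_sub_distrib]
  rw [targetMetric, Matrix.fromBlocks_mulVec, sumElim_dotProduct_sumElim]
  simp only [Sum.elim_comp_inl, Sum.elim_comp_inr, Matrix.zero_mulVec, add_zero, zero_add, h1,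
    Matrix.neg_mulVec, Matrix.one_mulVec, dotProduct, Pi.neg_apply, mul_sub, mul_neg,
    Finset.sum_sub_distrib, Finset.sum_neg_distrib, ← Finset.sum_mul, sq]
  ring

/-- The kinetic term in the target space. -/
theorem kinetic_eq {lam : ℕ → Fin 5 → ℝ} (hlam : IsB16Coupling lam) {c : Fin 16 → ℝ}
    {cphi : Fin 5 → ℝ} (hc : LinearConstraints lam c cphi) (p : Fin 10 → ℝ) :
    ∑ i : Fin 15, (scaleSum p i.succ + c i.succ) ^ 2 - (scaleSum p 0 + c 0) ^ 2
      - ∑ α, (scalarSum lam p α + cphi α) ^ 2 =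
    (1 / 4) * ∑ s, ∑ s', (e10 s s' : ℝ) * p s * p s' + constNorm c cphi := by
  -- The velocity vector splits as `V + C`. The part `V` lies in the span of the duals of the `U^s`,
  -- to which `C` is orthogonal by the linear constraints, so the cross terms vanish.
  set C : Fin 15 ⊕ Fin 5 → ℝ := Sum.elim (fun i : Fin 15 => c i.succ) cphi with hC
  set V : Fin 15 ⊕ Fin 5 → ℝ := ∑ s, (p s / 2) • braneDir lam s with hV
  have hsum : Sum.elim (fun i : Fin 15 => scaleSum p i.succ + c i.succ)
      (fun α => scalarSum lam p α + cphi α) = V + C := by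
    rw [hV, ← sumElim_eq_sum_braneDir]
    funext A
    cases A <;> rfl
  have hGV : targetMetric *ᵥ V = ∑ s, (p s / 2) • braneVec lam s := by
    rw [hV, Matrix.mulVec_sum]
    refine Finset.sum_congr rfl fun s _ => ?_
    rw [Matrix.mulVec_smul, targetMetric_mulVec_braneDir]
  have hVC : V ⬝ᵥ (targetMetric *ᵥ C) = 0 := by
    rw [Matrix.dotProduct_mulVec, ← Matrix.mulVec_transpose, targetMetric_isSymm, hGV,
      sum_dotProduct]
    exact Finset.sum_eq_zero fun s _ => by rw [smul_dotProduct, hc.brane, smul_zero]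
  have hCV : C ⬝ᵥ (targetMetric *ᵥ V) = 0 := by
    rw [hGV, dotProduct_sum]
    exact Finset.sum_eq_zero fun s _ => by
      rw [dotProduct_smul, dotProduct_comm, hc.brane, smul_zero]
  have hVV : V ⬝ᵥ (targetMetric *ᵥ V) = (1 / 4) * ∑ s, ∑ s', (e10 s s' : ℝ) * p s * p s' := by
    rw [hGV, dotProduct_sum, Finset.mul_sum]
    refine Finset.sum_congr rfl fun s _ => ?_
    rw [dotProduct_smul, dotProduct_comm, hV, braneVec_dotProduct_sum hlam, smul_eq_mul,
      Finset.mul_sum, Finset.mul_sum, Finset.mul_sum]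
    exact Finset.sum_congr rfl fun s' _ => by ring
  have h1 := targetMetric_norm (fun i : Fin 15 => scaleSum p i.succ + c i.succ)
    (fun α => scalarSum lam p α + cphi α)
  have h2 := targetMetric_norm (fun i : Fin 15 => c i.succ) cphi
  rw [hsum, Matrix.mulVec_add, dotProduct_add, add_dotProduct, add_dotProduct, hVV, hVC, hCV,
    h2, Finset.sum_add_distrib, sum_scaleSum, ← hc.zero] at h1
  rw [constNorm, ← hc.zero]
  linear_combination -h1

/-- `U^s` evaluated on the exponents of the solution. -/
theorem braneVec_exponents {lam : ℕ → Fin 5 → ℝ} (hlam : IsB16Coupling lam) {c cbar : Fin 16 → ℝ}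
    {cphi cphibar : Fin 5 → ℝ} (hc : LinearConstraints lam c cphi)
    (hcbar : LinearConstraints lam cbar cphibar) (p : Fin 10 → ℝ) (t : ℝ) (s : Fin 10) :
    ∑ μ ∈ braneSet s, (scaleSum p μ + c μ * t + cbar μ)
      - chi s * ∑ α, lam (colour s) α * (scalarSum lam p α + cphi α * t + cphibar α) =
    (1 / 2) * ∑ s', (e10 s s' : ℝ) * p s' := by
  have h : braneVec lam s ⬝ᵥ Sum.elim (fun i : Fin 15 => scaleSum p i.succ + c i.succ * t + cbar i.succ)
      (fun α => scalarSum lam p α + cphi α * t + cphibar α) =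
      (1 / 2) * ∑ s', (e10 s s' : ℝ) * p s' := by
    have : Sum.elim (fun i : Fin 15 => scaleSum p i.succ + c i.succ * t + cbar i.succ)
      (fun α => scalarSum lam p α + cphi α * t + cphibar α) =
      (∑ s', (p s' / 2) • braneDir lam s') + t • Sum.elim (fun i : Fin 15 => c i.succ) cphi
        + Sum.elim (fun i : Fin 15 => cbar i.succ) cphibar := by
      rw [← sumElim_eq_sum_braneDir]
      funext A
      cases A <;> simp [mul_comm]
    rw [this, dotProduct_add, dotProduct_add, dotProduct_smul, hc.brane, hcbar.brane, smul_zero,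
      add_zero, add_zero, braneVec_dotProduct_sum hlam]
  rw [← h, braneVec, sumElim_dotProduct_sumElim, ← sum_mem_braneSet, dotProduct, dotProduct,
    Finset.mul_sum, sub_eq_add_neg, ← Finset.sum_neg_distrib]
  congr 1
  · exact Finset.sum_congr rfl fun i _ => by split_ifs <;> ring
  · exact Finset.sum_congr rfl fun α _ => by ring

/-- The exponents `γ^μ` of the metric. -/
noncomputable def scaleExp (q : Fin 10 → ℝ → ℝ) (c cbar : Fin 16 → ℝ) (μ : Fin 16) (t : ℝ) : ℝ :=
  scaleSum (fun s => q s t) μ + c μ * t + cbar μ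

/-- The scalar fields as functions of time. -/
noncomputable def scalarExp (lam : ℕ → Fin 5 → ℝ) (q : Fin 10 → ℝ → ℝ) (cphi cphibar : Fin 5 → ℝ)
    (α : Fin 5) (t : ℝ) : ℝ :=
  scalarSum lam (fun s => q s t) α + cphi α * t + cphibar α

/-- One formula covers `μ = 0` as well, since no brane set contains `0`. -/
theorem braneMetric_exp (q : Fin 10 → ℝ → ℝ) (c cbar : Fin 16 → ℝ) :
    braneMetric (fun s t => Real.exp (-q s t)) c cbar = timeMetric (scaleExp q c cbar) := by
  funext x
  rw [braneMetric, timeMetric, ← Matrix.diagonal_smul]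
  congr 1
  funext μ
  simp only [Pi.smul_apply, smul_eq_mul, ← Real.exp_mul, ← Real.exp_neg, ← Real.exp_sum, neg_neg,
    scaleExp, scaleSum, scaleWeight]
  rw [mul_assoc (ite _ _ _), mul_left_comm, ← Real.exp_add, ← Real.exp_add, sgn]
  congr 2
  rw [Finset.sum_filter, ← add_assoc, ← Finset.sum_add_distrib, mul_add, mul_add, Finset.mul_sum,
    ← add_assoc, mul_assoc]
  congr 2
  refine Finset.sum_congr rfl fun s _ => ?_
  split_ifs <;> ring

theorem braneScalar_exp (lam : ℕ → Fin 5 → ℝ) (q : Fin 10 → ℝ → ℝ) (cphi cphibar : Fin 5 → ℝ)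
    (α : Fin 5) (x : Pt) :
    braneScalar lam (fun s t => Real.exp (-q s t)) cphi cphibar α x =
      scalarExp lam q cphi cphibar α (x 0) := by
  rw [braneScalar, scalarExp, scalarSum, Finset.mul_sum]
  congr 2
  refine Finset.sum_congr rfl fun s _ => ?_
  rw [Real.log_exp]
  ring

theorem braneCoeff_exp (Q : Fin 10 → ℝ) (q : Fin 10 → ℝ → ℝ) (s : Fin 10) (t : ℝ) :
    braneCoeff Q (fun s t => Real.exp (-q s t)) s t =
      if s = 10 then Q s else Q s * Real.exp (∑ s', (e10 s s' : ℝ) * q s' t) := by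
  have : ∏ s', Real.exp (-q s' t) ^ (-e10 s s') = Real.exp (∑ s', (e10 s s' : ℝ) * q s' t) := by
    rw [Real.exp_sum]
    refine Finset.prod_congr rfl fun s' _ => ?_
    rw [← Real.rpow_intCast, ← Real.exp_mul]
    push_cast
    ring_nf
  rw [braneCoeff, this]

theorem scaleExp_zero {lam : ℕ → Fin 5 → ℝ} {c cbar : Fin 16 → ℝ} {cphi cphibar : Fin 5 → ℝ}
    (hc : LinearConstraints lam c cphi) (hcbar : LinearConstraints lam cbar cphibar)
    (q : Fin 10 → ℝ → ℝ) (t : ℝ) :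
    scaleExp q c cbar 0 t = ∑ i : Fin 15, scaleExp q c cbar i.succ t := by
  simp only [scaleExp, Finset.sum_add_distrib, ← Finset.sum_mul, sum_scaleSum, ← hc.zero,
    ← hcbar.zero]

/-- For an electric brane the left side is `-e^{-2γ⁰}` times the exponential of `-2U^s` on the
exponents. For the magnetic brane the product runs over the complementary indices. In the harmonic
gauge the product over all indices is `-e^{-4γ⁰}`, and dividing out leaves `e^{-2γ⁰}` times the
exponential of `+2U^s`. -/
theorem dilaton_mul_prod {lam : ℕ → Fin 5 → ℝ} (hlam : IsB16Coupling lam) {c cbar : Fin 16 → ℝ}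
    {cphi cphibar : Fin 5 → ℝ} (hc : LinearConstraints lam c cphi)
    (hcbar : LinearConstraints lam cbar cphibar) (q : Fin 10 → ℝ → ℝ) (t : ℝ) (s : Fin 10) :
    Real.exp (2 * ∑ α, lam (colour s) α * scalarExp lam q cphi cphibar α t) *
      ∏ μ ∈ formSupport s, (sgn μ * Real.exp (-(2 * scaleExp q c cbar μ t))) =
    -chi s * Real.exp (-(2 * scaleExp q c cbar 0 t)) *
      Real.exp (-chi s * ∑ s', (e10 s s' : ℝ) * q s' t) := by
  have hU := braneVec_exponents hlam hc hcbar (fun s => q s t) t s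
  have hI : ∏ μ ∈ braneSet s, (sgn μ * Real.exp (-(2 * scaleExp q c cbar μ t))) =
      Real.exp (-(2 * ∑ μ ∈ braneSet s, scaleExp q c cbar μ t)) := by
    rw [Finset.mul_sum, ← Finset.sum_neg_distrib, Real.exp_sum]
    refine Finset.prod_congr rfl fun μ hμ => ?_
    rw [sgn, if_neg, one_mul]
    rintro rfl
    exact zero_notMem_braneSet s hμ
  have hins : ∏ μ ∈ insert 0 (braneSet s), (sgn μ * Real.exp (-(2 * scaleExp q c cbar μ t))) =
      -Real.exp (-(2 * scaleExp q c cbar 0 t)) *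
        Real.exp (-(2 * ∑ μ ∈ braneSet s, scaleExp q c cbar μ t)) := by
    rw [Finset.prod_insert (zero_notMem_braneSet s), hI, sgn_zero, neg_one_mul]
  change ∑ μ ∈ braneSet s, scaleExp q c cbar μ t
    - chi s * ∑ α, lam (colour s) α * scalarExp lam q cphi cphibar α t = _ at hU
  by_cases hs : s = 10
  · have hall : ∏ μ, (sgn μ * Real.exp (-(2 * scaleExp q c cbar μ t))) =
        -Real.exp (-(2 * (2 * scaleExp q c cbar 0 t))) := by
      rw [Fin.prod_univ_succ]
      simp only [sgn_zero, sgn_succ, one_mul, ← Real.exp_sum, Finset.sum_neg_distrib,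
        ← Finset.mul_sum, ← scaleExp_zero hc hcbar]
      rw [neg_one_mul, neg_mul, ← Real.exp_add]
      ring_nf
    have hsd := Finset.prod_sdiff (f := fun μ => sgn μ * Real.exp (-(2 * scaleExp q c cbar μ t)))
      (Finset.subset_univ (insert 0 (braneSet s)))
    rw [hins, hall] at hsd
    have hchi : chi s = -1 := by subst hs; rfl
    rw [hchi] at hU ⊢
    rw [formSupport, if_pos hs]
    have hP : ∏ μ ∈ Finset.univ \ insert 0 (braneSet s),
        (sgn μ * Real.exp (-(2 * scaleExp q c cbar μ t))) =
        Real.exp (-(2 * scaleExp q c cbar 0 t)) *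
          Real.exp (2 * ∑ μ ∈ braneSet s, scaleExp q c cbar μ t) := by
      have e : Real.exp (-(2 * (2 * scaleExp q c cbar 0 t))) =
          Real.exp (-(2 * scaleExp q c cbar 0 t)) *
          Real.exp (2 * ∑ μ ∈ braneSet s, scaleExp q c cbar μ t) *
          (Real.exp (-(2 * scaleExp q c cbar 0 t)) *
          Real.exp (-(2 * ∑ μ ∈ braneSet s, scaleExp q c cbar μ t))) := by
        simp only [← Real.exp_add]
        ring_nf
      have hne : Real.exp (-(2 * scaleExp q c cbar 0 t)) *
          Real.exp (-(2 * ∑ μ ∈ braneSet s, scaleExp q c cbar μ t)) ≠ 0 := by positivity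
      refine mul_right_cancel₀ hne ?_
      rw [← e]
      linear_combination -hsd
    rw [hP, mul_left_comm, ← Real.exp_add, neg_neg, one_mul]
    congr 2
    linear_combination 2 * hU
  · have hchi : chi s = 1 := by
      rw [chi_eq, if_neg (show ¬s = 0 from hs)]; simp
    rw [hchi] at hU ⊢
    rw [formSupport, if_neg hs, hins, mul_left_comm, ← Real.exp_add, neg_one_mul, neg_one_mul]
    congr 2
    linear_combination -2 * hU

/-! ### Regularity and energy of the Toda chain -/

/-- `B_s = Q_s² exp(∑ A_{ss'} q^{s'})`. -/
noncomputable def todaSource (Q : Fin 10 → ℝ) (q : Fin 10 → ℝ → ℝ) (s : Fin 10) (t : ℝ) : ℝ :=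
  Q s ^ 2 * Real.exp (∑ s', (e10 s s' : ℝ) * q s' t)

theorem IsTodaSolution.hasDerivAt {Q : Fin 10 → ℝ} {J : Set ℝ} {q : Fin 10 → ℝ → ℝ}
    (hq : IsTodaSolution Q J q) {t : ℝ} (ht : t ∈ J) (s : Fin 10) :
    HasDerivAt (q s) (deriv (q s) t) t := (hq s t ht).1.hasDerivAt

theorem IsTodaSolution.hasDerivAt_deriv {Q : Fin 10 → ℝ} {J : Set ℝ} {q : Fin 10 → ℝ → ℝ}
    (hq : IsTodaSolution Q J q) {t : ℝ} (ht : t ∈ J) (s : Fin 10) :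
    HasDerivAt (deriv (q s)) (-2 * todaSource Q q s t) t := by
  rw [todaSource, ← mul_assoc]
  exact (hq s t ht).2

theorem IsTodaSolution.hasDerivAt_exponent {Q : Fin 10 → ℝ} {J : Set ℝ} {q : Fin 10 → ℝ → ℝ}
    (hq : IsTodaSolution Q J q) {t : ℝ} (ht : t ∈ J) (s : Fin 10) :
    HasDerivAt (fun t => ∑ s', (e10 s s' : ℝ) * q s' t) (∑ s', (e10 s s' : ℝ) * deriv (q s') t) t :=
  HasDerivAt.fun_sum fun s' _ => (hq.hasDerivAt ht s').const_mul _

/-- Bootstrap: if all `q^s` are of class `Cⁿ`, so is the right side of the Toda equation, hence the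
derivatives of the `q^s` are of class `Cⁿ⁺¹`. -/
theorem IsTodaSolution.contDiffOn {Q : Fin 10 → ℝ} {J : Set ℝ} (hJ : IsOpen J)
    {q : Fin 10 → ℝ → ℝ} (hq : IsTodaSolution Q J q) (s : Fin 10) : ContDiffOn ℝ ∞ (q s) J := by
  have key : ∀ n : ℕ, ∀ s, ContDiffOn ℝ n (q s) J ∧ ContDiffOn ℝ n (deriv (q s)) J := by
    intro n
    induction n with
    | zero =>
      intro s
      simp only [Nat.cast_zero, contDiffOn_zero]
      exact ⟨fun t ht => (hq.hasDerivAt ht s).continuousAt.continuousWithinAt,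
        fun t ht => (hq.hasDerivAt_deriv ht s).continuousAt.continuousWithinAt⟩
    | succ n ih =>
      intro s
      have hcast : ((n + 1 : ℕ) : WithTop ℕ∞) = (n : WithTop ℕ∞) + 1 := by norm_cast
      rw [hcast, contDiffOn_succ_iff_deriv_of_isOpen hJ, contDiffOn_succ_iff_deriv_of_isOpen hJ]
      refine ⟨⟨fun t ht => (hq.hasDerivAt ht s).differentiableAt.differentiableWithinAt,
        fun h => absurd h (by simp), (ih s).2⟩,
        ⟨fun t ht => (hq.hasDerivAt_deriv ht s).differentiableAt.differentiableWithinAt,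
        fun h => absurd h (by simp), ?_⟩⟩
      have : ContDiffOn ℝ n (fun t => -2 * todaSource Q q s t) J := by
        refine contDiffOn_const.mul (contDiffOn_const.mul (ContDiffOn.exp ?_))
        exact ContDiffOn.sum fun s' _ => contDiffOn_const.mul (ih s').1
      exact this.congr fun t ht => (hq.hasDerivAt_deriv ht s).deriv
  exact contDiffOn_infty.mpr fun n => (key n s).1

/-- Conservation of the energy of the Toda chain. -/
theorem IsTodaSolution.hasDerivAt_todaEnergy {Q : Fin 10 → ℝ} {J : Set ℝ} {q : Fin 10 → ℝ → ℝ}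
    (hq : IsTodaSolution Q J q) {t : ℝ} (ht : t ∈ J) : HasDerivAt (todaEnergy Q q) 0 t := by
  have h1 : HasDerivAt (fun t => (1 / 8) * ∑ s, ∑ s', (e10 s s' : ℝ) * deriv (q s) t * deriv (q s') t)
      ((1 / 8) * ∑ s, ∑ s', ((e10 s s' : ℝ) * (-2 * todaSource Q q s t) * deriv (q s') t
        + (e10 s s' : ℝ) * deriv (q s) t * (-2 * todaSource Q q s' t))) t :=
    (HasDerivAt.fun_sum fun s _ => HasDerivAt.fun_sum fun s' _ =>
      (((hq.hasDerivAt_deriv ht s).const_mul _).fun_mul (hq.hasDerivAt_deriv ht s'))).const_mul _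
  have h2 : HasDerivAt (fun t => (1 / 2) * ∑ s, Q s ^ 2 * Real.exp (∑ s', (e10 s s' : ℝ) * q s' t))
      ((1 / 2) * ∑ s, Q s ^ 2 * (Real.exp (∑ s', (e10 s s' : ℝ) * q s' t) *
        ∑ s', (e10 s s' : ℝ) * deriv (q s') t)) t :=
    (HasDerivAt.fun_sum fun s _ => ((hq.hasDerivAt_exponent ht s).exp).const_mul _).const_mul _
  refine (h1.fun_add h2).congr_deriv ?_
  -- By symmetry of `A` both halves of the kinetic derivative agree. Their sum is `-½ ∑ B_s A_{ss'}
  -- q̇^{s'}`, the opposite of the potential part.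
  have hsymm : ∑ s, ∑ s', (e10 s s' : ℝ) * deriv (q s) t * (-2 * todaSource Q q s' t) =
      ∑ s, ∑ s', (e10 s s' : ℝ) * (-2 * todaSource Q q s t) * deriv (q s') t := by
    rw [Finset.sum_comm]
    refine Finset.sum_congr rfl fun s _ => Finset.sum_congr rfl fun s' _ => ?_
    rw [e10_comm]
    ring
  simp only [Finset.sum_add_distrib, hsymm]
  rw [← two_mul, ← mul_assoc, Finset.mul_sum, Finset.mul_sum, ← Finset.sum_add_distrib]
  refine Finset.sum_eq_zero fun s _ => ?_
  simp only [todaSource, Finset.mul_sum, ← Finset.sum_add_distrib]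
  exact Finset.sum_eq_zero fun s' _ => by ring

theorem IsTodaSolution.todaEnergy_eq {Q : Fin 10 → ℝ} {J : Set ℝ} (hJ : IsOpen J)
    (hJ' : IsPreconnected J) {q : Fin 10 → ℝ → ℝ} (hq : IsTodaSolution Q J q) {t t' : ℝ}
    (ht : t ∈ J) (ht' : t' ∈ J) : todaEnergy Q q t = todaEnergy Q q t' := by
  obtain ⟨a, ha⟩ := hJ.exists_is_const_of_deriv_eq_zero hJ'
    (fun t ht => (hq.hasDerivAt_todaEnergy ht).differentiableAt.differentiableWithinAt)
    (fun t ht => (hq.hasDerivAt_todaEnergy ht).deriv)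
  rw [ha _ ht, ha _ ht']

/-! ### Auxiliary facts for the field equations -/

theorem hasDerivAt_scaleSum {q : Fin 10 → ℝ → ℝ} {p : Fin 10 → ℝ} {t : ℝ}
    (h : ∀ s, HasDerivAt (q s) (p s) t) (μ : Fin 16) :
    HasDerivAt (fun t => scaleSum (fun s => q s t) μ) (scaleSum p μ) t :=
  HasDerivAt.fun_sum fun s _ => ((h s).div_const 2).mul_const _

theorem hasDerivAt_scalarSum (lam : ℕ → Fin 5 → ℝ) {q : Fin 10 → ℝ → ℝ} {p : Fin 10 → ℝ} {t : ℝ}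
    (h : ∀ s, HasDerivAt (q s) (p s) t) (α : Fin 5) :
    HasDerivAt (fun t => scalarSum lam (fun s => q s t) α) (scalarSum lam p α) t :=
  HasDerivAt.fun_sum fun s _ => ((h s).div_const 2).mul_const _

theorem hasDerivAt_scaleExp {q : Fin 10 → ℝ → ℝ} {p : Fin 10 → ℝ} {t : ℝ} (c cbar : Fin 16 → ℝ)
    (h : ∀ s, HasDerivAt (q s) (p s) t) (μ : Fin 16) :
    HasDerivAt (scaleExp q c cbar μ) (scaleSum p μ + c μ) t := by
  have := ((hasDerivAt_scaleSum h μ).fun_add ((hasDerivAt_id' t).const_mul (c μ))).add_const (cbar μ)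
  rw [mul_one] at this
  exact this

theorem hasDerivAt_scalarExp (lam : ℕ → Fin 5 → ℝ) {q : Fin 10 → ℝ → ℝ} {p : Fin 10 → ℝ} {t : ℝ}
    (cphi cphibar : Fin 5 → ℝ) (h : ∀ s, HasDerivAt (q s) (p s) t) (α : Fin 5) :
    HasDerivAt (scalarExp lam q cphi cphibar α) (scalarSum lam p α + cphi α) t := by
  have := ((hasDerivAt_scalarSum lam h α).fun_add
    ((hasDerivAt_id' t).const_mul (cphi α))).add_const (cphibar α)
  rw [mul_one] at this
  exact this

theorem sum_colour_succ (f : Fin 10 → ℝ) :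
    ∑ n ∈ Finset.Icc 3 8, ∑ s with colour s = n + 1, f s = ∑ s, f s := by
  -- The natural-number subtraction is harmless: all degrees are at least `4`.
  have hm : ∀ s ∈ (Finset.univ : Finset (Fin 10)), colour s - 1 ∈ Finset.Icc 3 8 := by decide
  rw [← Finset.sum_fiberwise_of_maps_to hm]
  refine Finset.sum_congr rfl fun n _ => Finset.sum_congr (Finset.filter_congr fun s _ => ?_)
    fun _ _ => rfl
  have := Finset.mem_Icc.mp (colour_mem_Icc s)
  omega

theorem sum_colour (f : Fin 10 → ℝ) :
    ∑ a ∈ Finset.Icc 4 9, ∑ s with colour s = a, f s = ∑ s, f s :=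
  Finset.sum_fiberwise_of_maps_to (fun s _ => colour_mem_Icc s) f

/-- Passing to the complementary support flips the sign of `1_{M ∈ T} - ½`, and `χ = -1` flips it
back. Electric and magnetic branes therefore contribute to the stress tensor by the same formula. -/
theorem chi_mul_mem_formSupport (s : Fin 10) (M : Fin 16) :
    chi s * ((if M ∈ formSupport s then 1 else 0) - 1 / 2) =
      if M = 0 then 1 / 2 else (if M ∈ braneSet s then 1 else 0) - 1 / 2 := by
  have hm : ∀ s M, M ∈ formSupport s ↔ if s = 0 then ¬(M = 0 ∨ M ∈ braneSet s)
      else (M = 0 ∨ M ∈ braneSet s) := by decide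
  simp only [hm, chi_eq]
  by_cases hs : s = 0
  · by_cases hM : M = 0
    · norm_num [hs, hM]
    · by_cases hI : M ∈ braneSet 0 <;> norm_num [hs, hM, hI]
  · by_cases hM : M = 0 <;> norm_num [hs, hM]

theorem two_le_card_of_colour {a : ℕ} :
    ∀ s ∈ (Finset.univ.filter fun s => colour s = a), ∀ s' ∈
      (Finset.univ.filter fun s => colour s = a), s ≠ s' →
      2 ≤ (formSupport s \ formSupport s').card := fun s hs s' hs' h =>
  two_le_card_formSupport_sdiff s s'
    ((Finset.mem_filter.mp hs).2.trans (Finset.mem_filter.mp hs').2.symm) h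

theorem card_of_colour {a : ℕ} : ∀ s ∈ (Finset.univ.filter fun s => colour s = a),
    (formSupport s).card = a := fun s hs =>
  (card_formSupport s).trans (Finset.mem_filter.mp hs).2

theorem formSupport_ne_of_colour {a : ℕ} :
    ∀ s ∈ (Finset.univ.filter fun s => colour s = a), ∀ s' ∈
      (Finset.univ.filter fun s => colour s = a), s ≠ s' → formSupport s ≠ formSupport s' := by
  intro s hs s' hs' h he
  have := two_le_card_of_colour s hs s' hs' h
  rw [he, Finset.sdiff_self] at this
  simp at this

theorem dxComp_mul_prod {a : ℕ} {T : Finset (Fin 16)} (hT : T.card = a) (K : Fin a → Fin 16)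
    (h : Fin 16 → ℝ) : dxComp a T K * ∏ i, h (K i) = dxComp a T K * ∏ μ ∈ T, h μ := by
  by_cases h0 : dxComp a T K = 0
  · simp [h0]
  · obtain ⟨h1, h2⟩ := dxComp_ne_zero hT h0
    rw [← h2, Finset.prod_image (fun i _ j _ hij => h1 hij)]

theorem extDeriv_const {a : ℕ} (F : Pt [⋀^Fin a]→L[ℝ] ℝ) (x : Pt) :
    extDeriv (fun _ => F) x = 0 := by
  ext v
  rw [extDeriv_apply (differentiableAt_const _)]
  simp

theorem extDeriv_sum_eq_zero {a : ℕ} {ι : Type*} (S : Finset ι) (F : ι → DForm a) (x : Pt)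
    (h : ∀ i ∈ S, DifferentiableAt ℝ (F i) x) (h' : ∀ i ∈ S, extDeriv (F i) x = 0) :
    extDeriv (fun y => ∑ i ∈ S, F i y) x = 0 := by
  classical
  induction S using Finset.induction_on with
  | empty => simpa using extDeriv_const (0 : Pt [⋀^Fin a]→L[ℝ] ℝ) x
  | insert i S hi ih =>
    simp only [Finset.sum_insert hi]
    rw [extDeriv_fun_add (h i (Finset.mem_insert_self _ _))
      (DifferentiableAt.fun_sum fun j hj => h j (Finset.mem_insert_of_mem hj)),
      h' i (Finset.mem_insert_self _ _),
      ih (fun j hj => h j (Finset.mem_insert_of_mem hj))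
        (fun j hj => h' j (Finset.mem_insert_of_mem hj)), add_zero]

theorem zero_mem_formSupport : ∀ s, s ≠ 10 → (0 : Fin 16) ∈ formSupport s := by decide

theorem zero_notMem_formSupport_ten : (0 : Fin 16) ∉ formSupport 10 := by decide

/-! ### The solution governed by the Toda chain -/

section toda

variable {lam : ℕ → Fin 5 → ℝ} {Q : Fin 10 → ℝ} {J : Set ℝ} {q : Fin 10 → ℝ → ℝ}
  {c cbar : Fin 16 → ℝ} {cphi cphibar : Fin 5 → ℝ}

theorem dilatonFactor_scalarExp (x : Pt) (a : ℕ) :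
    dilatonFactor lam (fun α x => scalarExp lam q cphi cphibar α (x 0)) a x =
      Real.exp (2 * ∑ α, lam a α * scalarExp lam q cphi cphibar α (x 0)) := rfl

theorem formSq_brane (k : Fin 10 → ℝ → ℝ) (γ : Fin 16 → ℝ → ℝ) (a : ℕ) (x : Pt) :
    formSq (timeMetric γ) (braneForm k a) x =
      a ! * ∑ s with colour s = a, k s (x 0) ^ 2 *
        ∏ μ ∈ formSupport s, (sgn μ * Real.exp (-(2 * γ μ (x 0)))) :=
  formSq_sum (timeMetric_inv γ x) rfl card_of_colour formSupport_ne_of_colour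

theorem formContract_brane (k : Fin 10 → ℝ → ℝ) (γ : Fin 16 → ℝ → ℝ) (n : ℕ) (M N : Fin 16)
    (x : Pt) :
    formContract (timeMetric γ) (braneForm k (n + 1)) M N x =
      if M = N then n ! * ∑ s with colour s = n + 1, k s (x 0) ^ 2 *
        (if M ∈ formSupport s then sgn M * Real.exp (2 * γ M (x 0)) *
          ∏ μ ∈ formSupport s, (sgn μ * Real.exp (-(2 * γ μ (x 0)))) else 0) else 0 := by
  have hh : ∀ μ, sgn μ * Real.exp (-(2 * γ μ (x 0))) ≠ 0 := fun μ =>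
    mul_ne_zero (fun h => by have := sgn_mul_self μ; rw [h] at this; simp at this)
      (Real.exp_pos _).ne'
  have hinv : (sgn M * Real.exp (-(2 * γ M (x 0))))⁻¹ = sgn M * Real.exp (2 * γ M (x 0)) := by
    refine inv_eq_of_mul_eq_one_right ?_
    rw [mul_mul_mul_comm, sgn_mul_self, ← Real.exp_add]
    simp
  rw [formContract_sum (timeMetric_inv γ x) hh rfl card_of_colour two_le_card_of_colour, hinv]

/-- `e^{2λ_a·φ} k_s² ∏ g^{μμ} = -χ_s e^{-2γ⁰} B_s`. -/
theorem dilaton_mul_coeff_sq (hlam : IsB16Coupling lam) (hc : LinearConstraints lam c cphi)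
    (hcbar : LinearConstraints lam cbar cphibar) (Q : Fin 10 → ℝ) (q : Fin 10 → ℝ → ℝ) (t : ℝ)
    (s : Fin 10) :
    Real.exp (2 * ∑ α, lam (colour s) α * scalarExp lam q cphi cphibar α t) *
      (braneCoeff Q (fun s t => Real.exp (-q s t)) s t ^ 2 *
        ∏ μ ∈ formSupport s, (sgn μ * Real.exp (-(2 * scaleExp q c cbar μ t)))) =
    -chi s * Real.exp (-(2 * scaleExp q c cbar 0 t)) * todaSource Q q s t := by
  rw [mul_left_comm, dilaton_mul_prod hlam hc hcbar, braneCoeff_exp, todaSource]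
  by_cases hs : s = 10
  · subst hs
    rw [if_pos rfl, show chi 10 = -1 from rfl, neg_neg, one_mul, one_mul]
    ring
  · have hchi : chi s = 1 := by
      rw [chi_eq, if_neg (show ¬s = 0 from hs)]; simp
    have e : Real.exp (∑ s', (e10 s s' : ℝ) * q s' t) * Real.exp (-1 * ∑ s', (e10 s s' : ℝ) * q s' t)
        = 1 := by rw [← Real.exp_add, neg_one_mul, add_neg_cancel, Real.exp_zero]
    rw [if_neg hs, hchi]
    linear_combination (-Q s ^ 2 * Real.exp (-(2 * scaleExp q c cbar 0 t)) *
      Real.exp (∑ s', (e10 s s' : ℝ) * q s' t)) * e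

/-- `e^{2γ⁰} e^{2λ_a·φ} k_s ∏ g^{μμ}` is constant for the electric branes. -/
theorem dilaton_mul_coeff (hlam : IsB16Coupling lam) (hc : LinearConstraints lam c cphi)
    (hcbar : LinearConstraints lam cbar cphibar) (Q : Fin 10 → ℝ) (q : Fin 10 → ℝ → ℝ) (t : ℝ)
    (s : Fin 10) :
    Real.exp (2 * scaleExp q c cbar 0 t) *
      Real.exp (2 * ∑ α, lam (colour s) α * scalarExp lam q cphi cphibar α t) *
      (braneCoeff Q (fun s t => Real.exp (-q s t)) s t *
        ∏ μ ∈ formSupport s, (sgn μ * Real.exp (-(2 * scaleExp q c cbar μ t)))) =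
    if s = 10 then Q s * Real.exp (∑ s', (e10 s s' : ℝ) * q s' t) else -Q s := by
  rw [mul_assoc, mul_left_comm (Real.exp (2 * ∑ α, _)), dilaton_mul_prod hlam hc hcbar,
    braneCoeff_exp]
  have e0 : Real.exp (2 * scaleExp q c cbar 0 t) * Real.exp (-(2 * scaleExp q c cbar 0 t)) = 1 := by
    rw [← Real.exp_add, add_neg_cancel, Real.exp_zero]
  by_cases hs : s = 10
  · subst hs
    rw [if_pos rfl, if_pos rfl, show chi 10 = -1 from rfl, neg_neg, one_mul, one_mul]
    linear_combination (Q 10 * Real.exp (∑ s', (e10 10 s' : ℝ) * q s' t)) * e0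
  · have hchi : chi s = 1 := by
      rw [chi_eq, if_neg (show ¬s = 0 from hs)]; simp
    have e : Real.exp (∑ s', (e10 s s' : ℝ) * q s' t) * Real.exp (-1 * ∑ s', (e10 s s' : ℝ) * q s' t)
        = 1 := by rw [← Real.exp_add, neg_one_mul, add_neg_cancel, Real.exp_zero]
    rw [if_neg hs, if_neg hs, hchi]
    linear_combination (-Q s) * e0 - Q s * Real.exp (2 * scaleExp q c cbar 0 t) *
      Real.exp (-(2 * scaleExp q c cbar 0 t)) * e

/-- There are no cross terms between branes, so each one contributes `B_s` with a weight. The factor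
`χ_s` from `dilaton_mul_coeff_sq` is absorbed by `chi_mul_mem_formSupport`. -/
theorem formTerm_stress (hlam : IsB16Coupling lam) (hc : LinearConstraints lam c cphi)
    (hcbar : LinearConstraints lam cbar cphibar) (Q : Fin 10 → ℝ) (q : Fin 10 → ℝ → ℝ)
    (M N : Fin 16) (x : Pt) :
    ∑ n ∈ Finset.Icc 3 8,
      dilatonFactor lam (fun α x => scalarExp lam q cphi cphibar α (x 0)) (n + 1) x / ((n + 1)! : ℝ) *
        (((n : ℝ) + 1) * formContract (timeMetric (scaleExp q c cbar))
          (braneForm (braneCoeff Q fun s t => Real.exp (-q s t)) (n + 1)) M N x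
          - (1 / 2) * timeMetric (scaleExp q c cbar) x M N * formSq (timeMetric (scaleExp q c cbar))
          (braneForm (braneCoeff Q fun s t => Real.exp (-q s t)) (n + 1)) x) =
    if M = N then sgn M * Real.exp (2 * scaleExp q c cbar M (x 0) - 2 * scaleExp q c cbar 0 (x 0)) *
      -∑ s, (if M = 0 then 1 / 2 else (if M ∈ braneSet s then 1 else 0) - 1 / 2) *
        todaSource Q q s (x 0) else 0 := by
  by_cases hMN : M = N
  · subst hMN
    rw [if_pos rfl, ← sum_colour_succ, ← Finset.sum_neg_distrib, Finset.mul_sum]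
    refine Finset.sum_congr rfl fun n _ => ?_
    rw [← Finset.sum_neg_distrib, Finset.mul_sum, formContract_brane, formSq_brane, if_pos rfl,
      Nat.factorial_succ, timeMetric, Matrix.diagonal_apply_eq, dilatonFactor_scalarExp]
    have hn : (n ! : ℝ) ≠ 0 := by exact_mod_cast Nat.factorial_ne_zero n
    have hn1 : (n : ℝ) + 1 ≠ 0 := by positivity
    push_cast
    -- The factor `a = n + 1` and the `n!` enumerations of the contraction cancel `1/(n + 1)!`.
    have e : ∀ D G A B : ℝ, D / (((n : ℝ) + 1) * n !) * (((n : ℝ) + 1) * (n ! * A)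
        - 1 / 2 * G * (((n : ℝ) + 1) * n ! * B)) = D * (A - 1 / 2 * G * B) := by
      intro D G A B
      field_simp
    rw [e, Finset.mul_sum _ _ (1 / 2 * _), ← Finset.sum_sub_distrib, Finset.mul_sum]
    refine Finset.sum_congr rfl fun s hs => ?_
    have hk := dilaton_mul_coeff_sq hlam hc hcbar Q q (x 0) s
    rw [(Finset.mem_filter.mp hs).2] at hk
    rw [← chi_mul_mem_formSupport, sub_eq_add_neg (2 * scaleExp q c cbar M (x 0)), Real.exp_add]
    split_ifs
    · linear_combination (sgn M * Real.exp (2 * scaleExp q c cbar M (x 0)) * (1 / 2)) * hk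
    · linear_combination -(sgn M * Real.exp (2 * scaleExp q c cbar M (x 0)) * (1 / 2)) * hk
  · rw [if_neg hMN]
    refine Finset.sum_eq_zero fun n _ => ?_
    rw [formContract_brane, if_neg hMN, timeMetric, Matrix.diagonal_apply_ne _ hMN]
    ring

theorem contDiffOn_braneCoeff (hJ : IsOpen J) (hq : IsTodaSolution Q J q) (s : Fin 10) :
    ContDiffOn ℝ ∞ (braneCoeff Q (fun s t => Real.exp (-q s t)) s) J := by
  have : braneCoeff Q (fun s t => Real.exp (-q s t)) s = fun t =>
      if s = 10 then Q s else Q s * Real.exp (∑ s', (e10 s s' : ℝ) * q s' t) := by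
    funext t
    exact braneCoeff_exp Q q s t
  rw [this]
  by_cases hs : s = 10
  · simp only [hs, if_true]
    exact contDiffOn_const
  · simp only [hs, if_false]
    exact contDiffOn_const.mul (ContDiffOn.exp
      (ContDiffOn.sum fun s' _ => contDiffOn_const.mul (hq.contDiffOn hJ s')))

theorem contDiffOn_time {v : ℝ → ℝ} (hv : ContDiffOn ℝ ∞ v J) :
    ContDiffOn ℝ ∞ (fun x : Pt => v (x 0)) (region J) :=
  hv.comp (contDiff_apply ℝ ℝ (0 : Fin 16)).contDiffOn fun _ hx => hx

theorem contDiffOn_scaleExp (hJ : IsOpen J) (hq : IsTodaSolution Q J q) (μ : Fin 16) :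
    ContDiffOn ℝ ∞ (scaleExp q c cbar μ) J :=
  ((ContDiffOn.sum fun s _ => ((hq.contDiffOn hJ s).div_const 2).mul contDiffOn_const).add
    (contDiffOn_const.mul contDiffOn_id)).add contDiffOn_const

theorem contDiffOn_scalarExp (hJ : IsOpen J) (hq : IsTodaSolution Q J q) (α : Fin 5) :
    ContDiffOn ℝ ∞ (scalarExp lam q cphi cphibar α) J :=
  ((ContDiffOn.sum fun s _ => ((hq.contDiffOn hJ s).div_const 2).mul contDiffOn_const).add
    (contDiffOn_const.mul contDiffOn_id)).add contDiffOn_const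

/-- Only the `t`-derivative can survive. An electric flux density is constant in time, and the
magnetic one has no component with an index `0`. -/
theorem maxwell_toda (hlam : IsB16Coupling lam) (hq : IsTodaSolution Q J q)
    (hc : LinearConstraints lam c cphi) (hcbar : LinearConstraints lam cbar cphibar) {x : Pt}
    (hx : x ∈ region J) (n : ℕ) (K : Fin n → Fin 16) :
    ∑ M, pd M (fun y => volDensity (timeMetric (scaleExp q c cbar)) y *
      dilatonFactor lam (fun α x => scalarExp lam q cphi cphibar α (x 0)) (n + 1) y *
      compUp (timeMetric (scaleExp q c cbar))
        (braneForm (braneCoeff Q fun s t => Real.exp (-q s t)) (n + 1)) y (Fin.cons M K)) x = 0 := by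
  have hv : ∀ M, (fun y => volDensity (timeMetric (scaleExp q c cbar)) y *
      dilatonFactor lam (fun α x => scalarExp lam q cphi cphibar α (x 0)) (n + 1) y *
      compUp (timeMetric (scaleExp q c cbar))
        (braneForm (braneCoeff Q fun s t => Real.exp (-q s t)) (n + 1)) y (Fin.cons M K)) =
      fun y => (fun t => ∑ s with colour s = n + 1, dxComp (n + 1) (formSupport s) (Fin.cons M K) *
        (if s = 10 then Q s * Real.exp (∑ s', (e10 s s' : ℝ) * q s' t) else -Q s)) (y 0) := by
    intro M
    funext y
    rw [compUp_diagonal (timeMetric_inv _ y), formComp_sum rfl, Finset.mul_sum, Finset.mul_sum,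
      volDensity_timeMetric, sum_fin16, ← scaleExp_zero hc hcbar, ← two_mul, dilatonFactor_scalarExp]
    refine Finset.sum_congr rfl fun s hs => ?_
    rw [← dilaton_mul_coeff hlam hc hcbar, (Finset.mem_filter.mp hs).2]
    have := dxComp_mul_prod (card_of_colour s hs) (Fin.cons M K)
      (fun μ => sgn μ * Real.exp (-(2 * scaleExp q c cbar μ (y 0))))
    linear_combination (Real.exp (2 * scaleExp q c cbar 0 (y 0)) *
      Real.exp (2 * ∑ α, lam (n + 1) α * scalarExp lam q cphi cphibar α (y 0)) *
      braneCoeff Q (fun s t => Real.exp (-q s t)) s (y 0)) * this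
  refine Finset.sum_eq_zero fun M _ => ?_
  rw [hv]
  have hd : HasDerivAt (fun t => ∑ s with colour s = n + 1,
      dxComp (n + 1) (formSupport s) (Fin.cons M K) *
        (if s = 10 then Q s * Real.exp (∑ s', (e10 s s' : ℝ) * q s' t) else -Q s))
      (∑ s with colour s = n + 1, dxComp (n + 1) (formSupport s) (Fin.cons M K) *
        (if s = 10 then Q s * (Real.exp (∑ s', (e10 s s' : ℝ) * q s' (x 0)) *
          ∑ s', (e10 s s' : ℝ) * deriv (q s') (x 0)) else 0)) (x 0) := by
    refine HasDerivAt.fun_sum fun s _ => HasDerivAt.const_mul _ ?_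
    split_ifs
    · exact (hq.hasDerivAt_exponent hx s).exp.const_mul _
    · exact hasDerivAt_const _ _
  rw [pd_time hd]
  split_ifs with hM
  · subst hM
    refine Finset.sum_eq_zero fun s hs => ?_
    split_ifs with h10
    · have : dxComp (n + 1) (formSupport s) (Fin.cons 0 K) = 0 := by
        by_contra h
        have h2 := (dxComp_ne_zero (card_of_colour s hs) h).2
        rw [image_cons, h10] at h2
        exact zero_notMem_formSupport_ten (h2 ▸ Finset.mem_insert_self _ _)
      rw [this, zero_mul]
    · rw [mul_zero]
  · rfl

/-- The electric forms contain `dt` and have coefficients depending on `t` only; the magnetic form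
is constant. -/
theorem bianchi_toda (hJ : IsOpen J) (hq : IsTodaSolution Q J q) {x : Pt} (hx : x ∈ region J)
    (a : ℕ) : extDeriv (braneForm (braneCoeff Q fun s t => Real.exp (-q s t)) a) x = 0 := by
  have hk : ∀ s, DifferentiableAt ℝ (braneCoeff Q (fun s t => Real.exp (-q s t)) s) (x 0) := fun s =>
    ((contDiffOn_braneCoeff hJ hq s).differentiableOn (by simp)).differentiableAt (hJ.mem_nhds hx)
  refine extDeriv_sum_eq_zero _ (fun s y => braneCoeff Q (fun s t => Real.exp (-q s t)) s (y 0) •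
    dxSet a (formSupport s)) x (fun s _ => ?_) (fun s _ => ?_)
  · exact DifferentiableAt.smul_const
      (DifferentiableAt.comp (f := fun y : Pt => y 0) x (hk s) (differentiableAt_apply 0 x)) _
  · by_cases hs : s = 10
    · simp only [braneCoeff, hs, if_true]
      exact extDeriv_const _ x
    · exact extDeriv_time_smul_dxSet (zero_mem_formSupport s hs) (hk s)

/-- By the Toda equations the second derivative of `φ^α` is `-∑ χ_s λ_{a_s α} B_s`; the Laplacian
therefore cancels the form terms brane by brane. -/
theorem scalar_toda (hlam : IsB16Coupling lam) (hJ : IsOpen J) (hq : IsTodaSolution Q J q)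
    (hc : LinearConstraints lam c cphi) (hcbar : LinearConstraints lam cbar cphibar) {x : Pt}
    (hx : x ∈ region J) (α : Fin 5) :
    laplaceBeltrami (timeMetric (scaleExp q c cbar))
        (fun x => scalarExp lam q cphi cphibar α (x 0)) x
      + ∑ a ∈ Finset.Icc 4 9, lam a α / (a ! : ℝ) *
        dilatonFactor lam (fun α x => scalarExp lam q cphi cphibar α (x 0)) a x *
        formSq (timeMetric (scaleExp q c cbar))
          (braneForm (braneCoeff Q fun s t => Real.exp (-q s t)) a) x = 0 := by
  rw [laplaceBeltrami_time hJ (k := 0)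
    (fun t _ => by rw [scaleExp_zero hc hcbar q t, add_zero]) hx (fun _ _ => rfl)
    (fun t ht => hasDerivAt_scalarExp lam cphi cphibar (hq.hasDerivAt ht) α)
    ((hasDerivAt_scalarSum lam (hq.hasDerivAt_deriv hx) α).add_const _)]
  have e : ∀ a : ℕ, lam a α / (a ! : ℝ) *
        dilatonFactor lam (fun α x => scalarExp lam q cphi cphibar α (x 0)) a x *
        formSq (timeMetric (scaleExp q c cbar))
          (braneForm (braneCoeff Q fun s t => Real.exp (-q s t)) a) x =
      ∑ s with colour s = a, lam (colour s) α * (-chi s *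
        Real.exp (-(2 * scaleExp q c cbar 0 (x 0))) * todaSource Q q s (x 0)) := by
    intro a
    have ha : (a ! : ℝ) ≠ 0 := by exact_mod_cast Nat.factorial_ne_zero a
    rw [formSq_brane, dilatonFactor_scalarExp]
    have e1 : ∀ l D S : ℝ, l / (a ! : ℝ) * D * (a ! * S) = (l * D) * S := by
      intro l D S
      field_simp
    rw [e1, Finset.mul_sum]
    refine Finset.sum_congr rfl fun s hs => ?_
    rw [← dilaton_mul_coeff_sq hlam hc hcbar, (Finset.mem_filter.mp hs).2]
    ring
  rw [Finset.sum_congr rfl fun a _ => e a, sum_colour, scalarSum, Finset.mul_sum,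
    ← Finset.sum_add_distrib]
  exact Finset.sum_eq_zero fun s _ => by ring

theorem einstein_toda (hlam : IsB16Coupling lam) (hJ : IsOpen J) (hq : IsTodaSolution Q J q)
    (hc : LinearConstraints lam c cphi) (hcbar : LinearConstraints lam cbar cphibar) {x : Pt}
    (hx : x ∈ region J) (hE : 2 * todaEnergy Q q (x 0) + constNorm c cphi = 0) (M N : Fin 16) :
    ricci (timeMetric (scaleExp q c cbar)) M N x - (1 / 2) * timeMetric (scaleExp q c cbar) x M N *
        scalarCurv (timeMetric (scaleExp q c cbar)) x =
      stressTensor lam (timeMetric (scaleExp q c cbar))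
        (fun α x => scalarExp lam q cphi cphibar α (x 0))
        (braneForm (braneCoeff Q fun s t => Real.exp (-q s t))) M N x := by
  have h1 : ∀ μ, ∀ t ∈ J, HasDerivAt (scaleExp q c cbar μ)
      (scaleSum (fun s => deriv (q s) t) μ + c μ) t := fun μ t ht =>
    hasDerivAt_scaleExp c cbar (hq.hasDerivAt ht) μ
  have h2 : ∀ μ, ∀ t ∈ J, HasDerivAt (fun t => scaleSum (fun s => deriv (q s) t) μ + c μ)
      (scaleSum (fun s => -2 * todaSource Q q s t) μ) t := fun μ t ht =>
    (hasDerivAt_scaleSum (hq.hasDerivAt_deriv ht) μ).add_const _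
  have hphi : ∀ α, HasDerivAt (scalarExp lam q cphi cphibar α)
      (scalarSum lam (fun s => deriv (q s) (x 0)) α + cphi α) (x 0) := fun α =>
    hasDerivAt_scalarExp lam cphi cphibar (hq.hasDerivAt hx) α
  have hkin := kinetic_eq hlam hc (fun s => deriv (q s) (x 0))
  -- The energy constraint enters here: `2E_T` is the Toda part of the kinetic norm plus `∑ B_s`.
  have hnorm : ∑ i : Fin 15, (scaleSum (fun s => deriv (q s) (x 0)) i.succ + c i.succ) ^ 2
      - (scaleSum (fun s => deriv (q s) (x 0)) 0 + c 0) ^ 2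
      = ∑ α, (scalarSum lam (fun s => deriv (q s) (x 0)) α + cphi α) ^ 2
        - ∑ s, todaSource Q q s (x 0) := by
    rw [todaEnergy] at hE
    simp only [todaSource]
    linear_combination hkin + hE
  rw [einstein_timeMetric hJ h1 h2
    (fun t _ => by rw [Finset.sum_add_distrib, sum_scaleSum, ← hc.zero])
    (fun t _ => (sum_scaleSum _).symm) hx, stressTensor, formTerm_stress hlam hc hcbar, hnorm]
  simp only [pd_time (hphi _), gradInner_time hJ hx (fun _ _ => rfl) (hphi _)]
  by_cases hMN : M = N
  · subst hMN
    rw [if_pos rfl, if_pos rfl, timeMetric, Matrix.diagonal_apply_eq,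
      sub_eq_add_neg (2 * scaleExp q c cbar M (x 0)), Real.exp_add]
    have e0 : Real.exp (2 * scaleExp q c cbar 0 (x 0)) *
        Real.exp (-(2 * scaleExp q c cbar 0 (x 0))) = 1 := by
      rw [← Real.exp_add, add_neg_cancel, Real.exp_zero]
    by_cases hM : M = 0
    · subst hM
      simp only [if_true, sgn_zero, Finset.sum_sub_distrib, ← Finset.mul_sum, ← sq]
      linear_combination (-(∑ α, (scalarSum lam (fun s => deriv (q s) (x 0)) α + cphi α) ^ 2)) * e0
    · simp only [hM, if_false, sub_mul, Finset.sum_sub_distrib, ← Finset.mul_sum, mul_zero, zero_sub]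
      -- The common weight `-d(I_s)/14` drops out of the difference, leaving only the branes that
      -- wrap the direction `M`.
      have hw : scaleSum (fun s => -2 * todaSource Q q s (x 0)) M
          - scaleSum (fun s => -2 * todaSource Q q s (x 0)) 0 =
          -∑ s, (if M ∈ braneSet s then (1 : ℝ) else 0) * todaSource Q q s (x 0) := by
        simp only [scaleSum, scaleWeight, zero_notMem_braneSet, if_false]
        rw [← Finset.sum_sub_distrib, ← Finset.sum_neg_distrib]
        exact Finset.sum_congr rfl fun s _ => by ring
      rw [hw, Finset.sum_neg_distrib, ← Finset.mul_sum, ← Finset.mul_sum]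
      ring
  · rw [if_neg hMN, if_neg hMN, timeMetric, Matrix.diagonal_apply_ne _ hMN]
    have : ∀ p : ℝ, ((if M = 0 then p else 0) * if N = 0 then p else 0) = 0 := by
      intro p
      by_cases hM : M = 0
      · rw [if_neg (fun hN : N = 0 => hMN (hM.trans hN.symm)), mul_zero]
      · rw [if_neg hM, zero_mul]
    simp [this]

/-- Every solution of the Toda equations that obeys the energy constraint gives a solution of the
`B₁₆`-model. -/
theorem solvesB16_of_isTodaSolution (hlam : IsB16Coupling lam) (hJ : IsOpen J)
    (hq : IsTodaSolution Q J q) (hc : LinearConstraints lam c cphi)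
    (hcbar : LinearConstraints lam cbar cphibar)
    (hE : ∀ t ∈ J, 2 * todaEnergy Q q t + constNorm c cphi = 0) :
    SolvesB16 lam (region J)
      (braneMetric (fun s t => Real.exp (-q s t)) c cbar)
      (braneScalar lam (fun s t => Real.exp (-q s t)) cphi cphibar)
      (braneForm (braneCoeff Q fun s t => Real.exp (-q s t))) := by
  have hs : braneScalar lam (fun s t => Real.exp (-q s t)) cphi cphibar =
      fun α x => scalarExp lam q cphi cphibar α (x 0) := by
    funext α x
    exact braneScalar_exp lam q cphi cphibar α x
  rw [braneMetric_exp, hs]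
  refine ⟨fun M N => ?_, fun α => contDiffOn_time (contDiffOn_scalarExp hJ hq α), fun a _ => ?_,
    fun x _ => isLorentzian_timeMetric _ x,
    fun x hx M N => einstein_toda hlam hJ hq hc hcbar hx (hE _ hx) M N,
    fun x hx α => scalar_toda hlam hJ hq hc hcbar hx α,
    fun x hx n _ K => maxwell_toda hlam hq hc hcbar hx n K,
    fun x hx a _ => bianchi_toda hJ hq hx a⟩
  · by_cases hMN : M = N
    · subst hMN
      simp only [timeMetric, Matrix.diagonal_apply_eq]
      exact contDiffOn_const.mul (ContDiffOn.exp (contDiffOn_const.mul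
        (contDiffOn_time (contDiffOn_scaleExp hJ hq M))))
    · simp only [timeMetric, Matrix.diagonal_apply_ne _ hMN]
      exact contDiffOn_const
  · exact ContDiffOn.sum fun s _ =>
      (contDiffOn_time (contDiffOn_braneCoeff hJ hq s)).smul contDiffOn_const

end toda

/-! ### Locality of the field equations -/

section congr

variable {lam : ℕ → Fin 5 → ℝ} {W : Set Pt} {g g' : MetricField} {phi phi' : Fin 5 → Pt → ℝ}
  {F F' : (a : ℕ) → DForm a} {x : Pt}

theorem pd_congr_of_eqOn (hW : IsOpen W) {u v : Pt → ℝ} (h : ∀ y ∈ W, u y = v y) (hx : x ∈ W)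
    (μ : Fin 16) : pd μ u x = pd μ v x :=
  pd_congr (Filter.eventually_of_mem (hW.mem_nhds hx) h) μ

theorem christoffel_congr (hW : IsOpen W) (hg : ∀ y ∈ W, g' y = g y) (hx : x ∈ W)
    (L M N : Fin 16) : christoffel g' L M N x = christoffel g L M N x := by
  have h : ∀ K M N, pd K (fun y => g' y M N) x = pd K (fun y => g y M N) x := fun K M N =>
    pd_congr_of_eqOn hW (fun y hy => by rw [hg y hy]) hx K
  simp only [christoffel, hg x hx, h]

theorem ricci_congr (hW : IsOpen W) (hg : ∀ y ∈ W, g' y = g y) (hx : x ∈ W) (M N : Fin 16) :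
    ricci g' M N x = ricci g M N x := by
  have h : ∀ K L M N, pd K (christoffel g' L M N) x = pd K (christoffel g L M N) x :=
    fun K L M N => pd_congr_of_eqOn hW (fun y hy => christoffel_congr hW hg hy L M N) hx K
  simp only [ricci, h, christoffel_congr hW hg hx]

/-- Openness of `W` makes derivatives agree too. This is needed because the explicit solutions agree
with the Toda form only where `f̄` does not vanish. -/
theorem SolvesB16.congr (hW : IsOpen W) (h : SolvesB16 lam W g phi F)
    (hg : ∀ x ∈ W, g' x = g x) (hphi : ∀ α, ∀ x ∈ W, phi' α x = phi α x)
    (hF : ∀ a, ∀ x ∈ W, F' a x = F a x) : SolvesB16 lam W g' phi' F' := by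
  have hpd : ∀ x ∈ W, ∀ μ α, pd μ (phi' α) x = pd μ (phi α) x := fun x hx μ α =>
    pd_congr_of_eqOn hW (hphi α) hx μ
  have hvol : ∀ x ∈ W, volDensity g' x = volDensity g x := fun x hx => by
    simp only [volDensity, hg x hx]
  have hdil : ∀ x ∈ W, ∀ a, dilatonFactor lam phi' a x = dilatonFactor lam phi a x :=
    fun x hx a => by simp only [dilatonFactor, hphi _ x hx]
  have hcomp : ∀ a, ∀ x ∈ W, ∀ K, formComp (F' a) x K = formComp (F a) x K := fun a x hx K => by
    simp only [formComp, hF a x hx]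
  have hup : ∀ a, ∀ x ∈ W, ∀ K, compUp g' (F' a) x K = compUp g (F a) x K := fun a x hx K => by
    simp only [compUp, hg x hx, hcomp a x hx]
  have hsq : ∀ a, ∀ x ∈ W, formSq g' (F' a) x = formSq g (F a) x := fun a x hx => by
    simp only [formSq, hcomp a x hx, hup a x hx]
  refine ⟨fun M N => (h.smooth_metric M N).congr fun x hx => by rw [hg x hx],
    fun α => (h.smooth_scalar α).congr (hphi α),
    fun a ha => (h.smooth_form a ha).congr (hF a),
    fun x hx => by rw [hg x hx]; exact h.lorentzian x hx,
    fun x hx M N => ?_, fun x hx α => ?_, fun x hx n hn K => ?_, fun x hx a ha => ?_⟩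
  · have := h.einstein x hx M N
    simp only [stressTensor, scalarCurv, gradInner, formContract] at this ⊢
    simpa only [ricci_congr hW hg hx, hg x hx, hpd x hx, hdil x hx, hcomp _ x hx, hsq _ x hx]
      using this
  · have e : laplaceBeltrami g' (phi' α) x = laplaceBeltrami g (phi α) x := by
      rw [laplaceBeltrami, laplaceBeltrami, hvol x hx]
      congr 1
      exact Finset.sum_congr rfl fun M _ =>
        pd_congr_of_eqOn hW (fun y hy => by simp only [hvol y hy, hg y hy, hpd y hy]) hx M
    simpa only [e, hdil x hx, hsq _ x hx] using h.scalar x hx α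
  · rw [← h.maxwell x hx n hn K]
    exact Finset.sum_congr rfl fun M _ =>
      pd_congr_of_eqOn hW (fun y hy => by rw [hvol y hy, hdil y hy, hup _ y hy]) hx M
  · rw [← h.bianchi x hx a ha]
    exact Filter.EventuallyEq.extDeriv_eq (Filter.eventually_of_mem (hW.mem_nhds hx) (hF a))

end congr

/-! ### The special one-block solution -/

/-- The hyperbolic, trigonometric and linear cases share `H'' = C H` and the first integral `H'² - C
H² = 2Q²`. Nothing else about `f̄` is needed for the Toda equations. -/
theorem exists_hasDerivAt_fbar (q C t₀ : ℝ) : ∃ H1 : ℝ → ℝ,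
    (∀ t, HasDerivAt (fbar q C t₀) (H1 t) t) ∧ (∀ t, HasDerivAt H1 (C * fbar q C t₀ t) t) ∧
    ∀ t, H1 t ^ 2 - C * fbar q C t₀ t ^ 2 = 2 * q ^ 2 := by
  have hlin : ∀ k t : ℝ, HasDerivAt (fun t => k * (t - t₀)) k t := fun k t => by
    simpa using ((hasDerivAt_id' t).sub_const t₀).const_mul k
  rcases lt_trichotomy C 0 with hC | hC | hC
  · have hf : fbar q C t₀ =
        fun t => |q| * Real.sqrt (2 / |C|) * Real.sin (Real.sqrt |C| * (t - t₀)) := by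
      funext t
      rw [fbar, if_neg hC.not_gt, if_pos hC]
    have hCpos : 0 < |C| := abs_pos.mpr hC.ne
    have e1 : Real.sqrt |C| * Real.sqrt |C| = -C := by
      rw [Real.mul_self_sqrt hCpos.le, abs_of_neg hC]
    have e2 : Real.sqrt (2 / |C|) ^ 2 * -C = 2 := by
      rw [Real.sq_sqrt (by positivity), ← abs_of_neg hC, div_mul_cancel₀ _ hCpos.ne']
    rw [hf]
    refine ⟨fun t => |q| * Real.sqrt (2 / |C|) *
      (Real.cos (Real.sqrt |C| * (t - t₀)) * Real.sqrt |C|), fun t => ?_, fun t => ?_, fun t => ?_⟩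
    · exact (hlin _ t).sin.const_mul _
    · refine (((hlin _ t).cos.mul_const _).const_mul _).congr_deriv ?_
      linear_combination (-|q| * Real.sqrt (2 / |C|) * Real.sin (Real.sqrt |C| * (t - t₀))) * e1
    · have hs := Real.sin_sq_add_cos_sq (Real.sqrt |C| * (t - t₀))
      have hq := sq_abs q
      linear_combination (|q| ^ 2 * Real.sqrt (2 / |C|) ^ 2 *
        Real.cos (Real.sqrt |C| * (t - t₀)) ^ 2) * e1 + (|q| ^ 2 * Real.sqrt (2 / |C|) ^ 2 * -C) * hs
        + |q| ^ 2 * e2 + 2 * hq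
  · have hf : fbar q C t₀ = fun t => |q| * Real.sqrt 2 * (t - t₀) := by
      funext t
      rw [fbar, if_neg (by rw [hC]; exact lt_irrefl _), if_neg (by rw [hC]; exact lt_irrefl _)]
    rw [hf]
    refine ⟨fun _ => |q| * Real.sqrt 2, fun t => hlin _ t, fun t => ?_, fun t => ?_⟩
    · rw [hC, zero_mul]
      exact hasDerivAt_const _ _
    · rw [hC, mul_pow, sq_abs, Real.sq_sqrt (by norm_num)]
      ring
  · have hf : fbar q C t₀ =
        fun t => |q| * Real.sqrt (2 / C) * Real.sinh (Real.sqrt C * (t - t₀)) := by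
      funext t
      rw [fbar, if_pos hC]
    have e1 : Real.sqrt C * Real.sqrt C = C := Real.mul_self_sqrt hC.le
    have e2 : Real.sqrt (2 / C) ^ 2 * C = 2 := by
      rw [Real.sq_sqrt (by positivity), div_mul_cancel₀ _ hC.ne']
    rw [hf]
    refine ⟨fun t => |q| * Real.sqrt (2 / C) *
      (Real.cosh (Real.sqrt C * (t - t₀)) * Real.sqrt C), fun t => ?_, fun t => ?_, fun t => ?_⟩
    · exact (hlin _ t).sinh.const_mul _
    · refine (((hlin _ t).cosh.mul_const _).const_mul _).congr_deriv ?_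
      linear_combination (|q| * Real.sqrt (2 / C) * Real.sinh (Real.sqrt C * (t - t₀))) * e1
    · have hs := Real.cosh_sq_sub_sinh_sq (Real.sqrt C * (t - t₀))
      have hq := sq_abs q
      linear_combination (|q| ^ 2 * Real.sqrt (2 / C) ^ 2 *
        Real.cosh (Real.sqrt C * (t - t₀)) ^ 2) * e1 + (|q| ^ 2 * Real.sqrt (2 / C) ^ 2 * C) * hs
        + |q| ^ 2 * e2 + 2 * hq

/-- Evenness makes `f̄^{b_s}` positive also where `f̄` is negative. -/
theorem even_bNum : ∀ s, Even (bNum s) := by decide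

theorem zpow_bNum_pos {h : ℝ} (hh : h ≠ 0) (s : Fin 10) : 0 < h ^ bNum s :=
  (even_bNum s).zpow_pos hh

theorem abs_bNum (s : Fin 10) : |(bNum s : ℝ)| = -bNum s :=
  abs_of_neg (by exact_mod_cast bNum_neg s)

theorem sum_e10_mul_bNum (s : Fin 10) : ∑ s', (e10 s s' : ℝ) * (bNum s' : ℝ) = 2 := by
  exact_mod_cast e10_mul_bNum s

theorem prod_zpow_bNum {h : ℝ} (hh : h ≠ 0) (s : Fin 10) :
    ∏ s', (h ^ bNum s') ^ (-e10 s s') = h ^ (-2 : ℤ) := by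
  have hp : ∀ (S : Finset (Fin 10)) (n : Fin 10 → ℤ), ∏ i ∈ S, h ^ n i = h ^ ∑ i ∈ S, n i := by
    intro S n
    induction S using Finset.induction_on with
    | empty => simp
    | insert i S hi ih => rw [Finset.prod_insert hi, Finset.sum_insert hi, ih, zpow_add₀ hh]
  simp only [← _root_.zpow_mul]
  rw [hp]
  congr 1
  rw [← e10_mul_bNum s, ← Finset.sum_neg_distrib]
  exact Finset.sum_congr rfl fun s' _ => by ring

section oneBlock

variable {lam : ℕ → Fin 5 → ℝ} {J : Set ℝ} {Q : Fin 10 → ℝ} {Q₀ C t₀ : ℝ}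

theorem exp_neg_neg_log_zpow {h : ℝ} (hh : h ≠ 0) (s : Fin 10) :
    Real.exp (-(-Real.log (h ^ bNum s))) = h ^ bNum s := by
  rw [neg_neg, Real.exp_log (zpow_bNum_pos hh s)]

theorem todaSource_oneBlock {h : ℝ} (hh : h ≠ 0) (s : Fin 10) :
    Real.exp (∑ s', (e10 s s' : ℝ) * -Real.log (h ^ bNum s')) = (h ^ 2)⁻¹ := by
  have : ∑ s', (e10 s s' : ℝ) * -Real.log (h ^ bNum s') = -Real.log (h ^ 2) := by
    rw [Real.log_pow]
    push_cast
    rw [← sum_e10_mul_bNum s, Finset.sum_mul, ← Finset.sum_neg_distrib]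
    refine Finset.sum_congr rfl fun s' _ => ?_
    rw [Real.log_zpow]
    ring
  rw [this, Real.exp_neg, Real.exp_log (by positivity)]

/-- All ten equations reduce to `(ln |H|)'' = (C H² - H'²)/H² = -2Q²/H²`. Since `∑ b_s = -2480`, the
energy is `-620 (H'² - 2Q²)/H² = -620 C`. -/
theorem isTodaSolution_oneBlock (hJ : IsOpen J) (hne : ∀ t ∈ J, fbar Q₀ C t₀ t ≠ 0)
    (hQ : ∀ s, Q s ^ 2 = Q₀ ^ 2 * |(bNum s : ℝ)|) :
    IsTodaSolution Q J (fun s t => -Real.log (fbar Q₀ C t₀ t ^ bNum s)) ∧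
    ∀ t ∈ J, todaEnergy Q (fun s t => -Real.log (fbar Q₀ C t₀ t ^ bNum s)) t = -620 * C := by
  obtain ⟨H1, hH, hH1, hsq⟩ := exists_hasDerivAt_fbar Q₀ C t₀
  set H := fbar Q₀ C t₀ with hHdef
  have hd : ∀ s, ∀ t ∈ J, HasDerivAt (fun t => -Real.log (H t ^ bNum s))
      (-(bNum s : ℝ) * (H1 t / H t)) t := by
    intro s t ht
    have : (fun t => -Real.log (H t ^ bNum s)) = fun t => -(bNum s : ℝ) * Real.log (H t) := by
      funext t
      -- No sign condition is needed: `Real.log` takes the absolute value, with `Real.log 0 = 0`.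
      rw [Real.log_zpow, neg_mul]
    rw [this]
    exact ((hH t).log (hne t ht)).const_mul _
  refine ⟨fun s t ht => ⟨(hd s t ht).differentiableAt, ?_⟩, fun t ht => ?_⟩
  · have hev : deriv (fun t => -Real.log (H t ^ bNum s)) =ᶠ[𝓝 t]
        fun t => -(bNum s : ℝ) * (H1 t / H t) :=
      Filter.eventually_of_mem (hJ.mem_nhds ht) fun y hy => (hd s y hy).deriv
    refine HasDerivAt.congr_of_eventuallyEq ?_ hev
    refine (((hH1 t).fun_div (hH t) (hne t ht)).const_mul (-(bNum s : ℝ))).congr_deriv ?_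
    rw [todaSource_oneBlock (hne t ht), hQ, abs_bNum, ← div_eq_mul_inv, ← mul_div_assoc]
    congr 1
    linear_combination (bNum s : ℝ) * hsq t
  · simp only [todaEnergy, todaSource_oneBlock (hne t ht), (hd _ t ht).deriv, hQ, abs_bNum]
    have hsum : ∑ s, (bNum s : ℝ) = -2480 := by exact_mod_cast sum_bNum
    have e1 : ∑ s, ∑ s', (e10 s s' : ℝ) * (-(bNum s : ℝ) * (H1 t / H t)) *
        (-(bNum s' : ℝ) * (H1 t / H t)) = -4960 * (H1 t / H t) ^ 2 := by
      have : ∀ s, ∑ s', (e10 s s' : ℝ) * (-(bNum s : ℝ) * (H1 t / H t)) *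
          (-(bNum s' : ℝ) * (H1 t / H t)) = (bNum s : ℝ) * (2 * (H1 t / H t) ^ 2) := by
        intro s
        rw [← sum_e10_mul_bNum s, Finset.sum_mul, Finset.mul_sum]
        exact Finset.sum_congr rfl fun s' _ => by ring
      rw [Finset.sum_congr rfl fun s _ => this s, ← Finset.sum_mul, hsum]
      ring
    have e2 : ∑ s, Q₀ ^ 2 * -(bNum s : ℝ) * (H t ^ 2)⁻¹ = 2480 * Q₀ ^ 2 * (H t ^ 2)⁻¹ := by
      rw [← Finset.sum_mul, ← Finset.mul_sum, Finset.sum_neg_distrib, hsum]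
      ring
    rw [e1, e2]
    have h0 := hne t ht
    field_simp
    linear_combination (-9920) * hsq t

theorem braneMetric_congr {f f' : Fin 10 → ℝ → ℝ} {x : Pt} (h : ∀ s, f s (x 0) = f' s (x 0))
    (c cbar : Fin 16 → ℝ) : braneMetric f c cbar x = braneMetric f' c cbar x := by
  simp only [braneMetric, h]

theorem braneScalar_congr {f f' : Fin 10 → ℝ → ℝ} {x : Pt} (h : ∀ s, f s (x 0) = f' s (x 0))
    (cphi cphibar : Fin 5 → ℝ) (α : Fin 5) :
    braneScalar lam f cphi cphibar α x = braneScalar lam f' cphi cphibar α x := by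
  simp only [braneScalar, h]

theorem braneForm_congr {k k' : Fin 10 → ℝ → ℝ} {x : Pt} (h : ∀ s, k s (x 0) = k' s (x 0))
    (a : ℕ) : braneForm k a x = braneForm k' a x := by
  simp only [braneForm, h]

theorem solvesB16_oneBlock (hlam : IsB16Coupling lam) (hJ : IsOpen J)
    (hne : ∀ t ∈ J, fbar Q₀ C t₀ t ≠ 0) (hQ : ∀ s, Q s ^ 2 = Q₀ ^ 2 * |(bNum s : ℝ)|)
    {c cbar : Fin 16 → ℝ} {cphi cphibar : Fin 5 → ℝ} (hc : LinearConstraints lam c cphi)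
    (hcbar : LinearConstraints lam cbar cphibar) (hE : 2 * (-620 * C) + constNorm c cphi = 0) :
    SolvesB16 lam (region J)
      (braneMetric (fun s t => fbar Q₀ C t₀ t ^ bNum s) c cbar)
      (braneScalar lam (fun s t => fbar Q₀ C t₀ t ^ bNum s) cphi cphibar)
      (braneForm (braneCoeff Q fun s t => fbar Q₀ C t₀ t ^ bNum s)) := by
  obtain ⟨hq, hen⟩ := isTodaSolution_oneBlock hJ hne hQ
  have hf : ∀ x ∈ region J, ∀ s, fbar Q₀ C t₀ (x 0) ^ bNum s =
      Real.exp (-(-Real.log (fbar Q₀ C t₀ (x 0) ^ bNum s))) := fun x hx s =>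
    (exp_neg_neg_log_zpow (hne _ hx) s).symm
  refine SolvesB16.congr (isOpen_region hJ)
    (solvesB16_of_isTodaSolution hlam hJ hq hc hcbar fun t ht => by rw [hen t ht, hE])
    (fun x hx => braneMetric_congr (hf x hx) c cbar)
    (fun α x hx => braneScalar_congr (hf x hx) cphi cphibar α)
    (fun a x hx => braneForm_congr (fun s => ?_) a)
  simp only [braneCoeff, ← hf x hx]

theorem braneCoeff_oneBlock {t : ℝ} (hne : fbar Q₀ C t₀ t ≠ 0) {s : Fin 10} (hs : s ≠ 10) :
    braneCoeff Q (fun s t => fbar Q₀ C t₀ t ^ bNum s) s t = Q s * fbar Q₀ C t₀ t ^ (-2 : ℤ) := by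
  rw [braneCoeff, if_neg hs, prod_zpow_bNum hne]

end oneBlock

/-! ### The solution with one harmonic function -/

section harmonic

variable {lam : ℕ → Fin 5 → ℝ} {Q ν : Fin 10 → ℝ} {Q₀ t₀ : ℝ}

theorem fbar_zero (q t₀ : ℝ) : fbar q 0 t₀ = fun t => |q| * Real.sqrt 2 * (t - t₀) := by
  funext t
  simp [fbar]

/-- Both `ν_s²` and `-b_s/2` solve the same linear system with the invertible matrix `A`. -/
theorem sq_of_braneProd (hlam : IsB16Coupling lam)
    (hν : ∀ s, ∑ s', braneProd lam s s' * ν s' ^ 2 = -1) (s : Fin 10) :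
    ν s ^ 2 = -(bNum s : ℝ) / 2 := by
  refine congrFun (eq_of_e10_mulVec_eq (u := fun s => ν s ^ 2) (v := fun s => -(bNum s : ℝ) / 2)
    fun s => ?_) s
  have h := hν s
  simp only [braneProd_eq_e10 hlam] at h
  rw [h]
  have h2 := sum_e10_mul_bNum s
  have : ∑ s', (e10 s s' : ℝ) * (-(bNum s' : ℝ) / 2) =
      -(∑ s', (e10 s s' : ℝ) * (bNum s' : ℝ)) / 2 := by
    rw [← Finset.sum_neg_distrib, Finset.sum_div]
    exact Finset.sum_congr rfl fun s' _ => by ring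
  rw [this, h2]
  norm_num

theorem charge_eq (hQ₀ : Q₀ ≠ 0) {Q ν b : ℝ} (hQ : Q ^ 2 = Q₀ ^ 2 * -b) (hν : ν ^ 2 = -b / 2)
    (hsign : SignType.sign ν = -SignType.sign Q) : Q = -(ν * (|Q₀| * Real.sqrt 2)) := by
  have hk : 0 < |Q₀| * Real.sqrt 2 := by positivity
  have h2 : Q ^ 2 = (ν * (|Q₀| * Real.sqrt 2)) ^ 2 := by
    rw [mul_pow, mul_pow, sq_abs, Real.sq_sqrt (by norm_num), hν, hQ]
    ring
  -- The root with the plus sign would give `Q` and `ν` equal signs, hence both would be zero, where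
  -- the two roots coincide.
  rcases sq_eq_sq_iff_eq_or_eq_neg.mp h2 with h | h
  · have hs : SignType.sign Q = SignType.sign ν := by
      rw [h, sign_mul, sign_pos hk, mul_one]
    rw [hs] at hsign
    have h0 : SignType.sign ν = 0 := by
      revert hsign
      cases SignType.sign ν <;> decide
    rw [h, sign_eq_zero_iff.mp h0]
    ring
  · exact h

theorem braneMetric_harmonic (hν : ∀ s, ν s ^ 2 = -(bNum s : ℝ) / 2) {H : ℝ → ℝ} {x : Pt}
    (hH : 0 < H (x 0)) :
    braneMetric (fun s t => H t ^ bNum s) 0 0 x = harmonicMetric ν H x := by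
  -- Writing `H` as an exponential turns the integer and real powers into sums of exponents, to be
  -- compared through `2ν_s² = -b_s`.
  obtain ⟨h, hh⟩ : ∃ h, H (x 0) = Real.exp h := ⟨_, (Real.exp_log hH).symm⟩
  have hz : ∀ n : ℤ, Real.exp h ^ n = Real.exp (h * n) := fun n => by
    rw [← Real.rpow_intCast, ← Real.exp_mul]
  simp only [braneMetric, harmonicMetric, hh, hz, ← Real.exp_mul, ← Real.exp_sum, hν]
  congr 1
  · congr 1
    rw [Finset.sum_mul]
    refine Finset.sum_congr rfl fun s _ => ?_
    ring
  · congr 1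
    funext μ
    by_cases hμ : μ = 0
    · subst hμ
      simp [zero_notMem_braneSet]
    · simp only [hμ, if_false, one_mul, Pi.zero_apply, mul_zero, zero_mul, add_zero, Real.exp_zero,
        mul_one, ← Real.exp_neg, ← Real.exp_sum]
      rw [Finset.sum_filter]
      congr 1
      refine Finset.sum_congr rfl fun s _ => ?_
      split_ifs <;> ring

theorem braneScalar_harmonic (hν : ∀ s, ν s ^ 2 = -(bNum s : ℝ) / 2) (H : ℝ → ℝ) (α : Fin 5)
    (x : Pt) : braneScalar lam (fun s t => H t ^ bNum s) 0 0 α x = harmonicScalar lam ν H α x := by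
  rw [braneScalar, harmonicScalar, Finset.mul_sum, ← Finset.sum_neg_distrib]
  simp only [Pi.zero_apply, zero_mul, add_zero, hν, Real.log_zpow]
  exact Finset.sum_congr rfl fun s _ => by ring

/-- With `H' = √2 |Q|`, the coefficient of `ν_s dH⁻¹` is `-ν_s H'/H² = Q_s H⁻²`, and that of `ν_s
*₀dH` is `-ν_s H' = Q_s`. -/
theorem braneCoeff_harmonic (hQ : ∀ s, Q s = -(ν s * (|Q₀| * Real.sqrt 2))) {t : ℝ}
    (hne : |Q₀| * Real.sqrt 2 * (t - t₀) ≠ 0) (s : Fin 10) :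
    braneCoeff Q (fun s t => (|Q₀| * Real.sqrt 2 * (t - t₀)) ^ bNum s) s t =
      harmonicCoeff ν (fun t => |Q₀| * Real.sqrt 2 * (t - t₀)) s t := by
  have hd : HasDerivAt (fun t => |Q₀| * Real.sqrt 2 * (t - t₀)) (|Q₀| * Real.sqrt 2) t := by
    simpa using ((hasDerivAt_id' t).sub_const t₀).const_mul (|Q₀| * Real.sqrt 2)
  rw [braneCoeff, harmonicCoeff, hd.deriv, (hd.fun_inv hne).deriv, prod_zpow_bNum hne, hQ]
  split_ifs
  · ring
  · rw [_root_.zpow_neg, zpow_ofNat]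
    ring

end harmonic

end

/-! ### Assembly of the four claims -/

theorem mainTheorem2 (lam : ℕ → Fin 5 → ℝ) (hlam : IsB16Coupling lam) :
    -- the configuration obeys the `E₁₀` intersection rules
    (∀ s, braneProd lam s s = 2) ∧
    (∀ s s', 2 * braneProd lam s s' / braneProd lam s' s' = (e10 s s' : ℝ)) ∧
    (∀ s s', s ≠ s' →
      ((braneSet s ∩ braneSet s').card : ℝ) = orthoIntersection lam s s' + (e10 s s' : ℝ)) ∧
    -- the solution governed by the `E₁₀` Toda chain
    (∀ (J : Set ℝ), IsOpen J → IsPreconnected J →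
      ∀ (Q : Fin 10 → ℝ), (∀ s, Q s ≠ 0) →
      ∀ (q : Fin 10 → ℝ → ℝ), IsTodaSolution Q J q →
        (∀ t ∈ J, ∀ t' ∈ J, todaEnergy Q q t = todaEnergy Q q t') ∧
        ∀ (c cbar : Fin 16 → ℝ) (cphi cphibar : Fin 5 → ℝ),
          LinearConstraints lam c cphi → LinearConstraints lam cbar cphibar →
          (∃ t ∈ J, 2 * todaEnergy Q q t + constNorm c cphi = 0) →
          SolvesB16 lam (region J)
            (braneMetric (fun s t => Real.exp (-q s t)) c cbar)
            (braneScalar lam (fun s t => Real.exp (-q s t)) cphi cphibar)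
            (braneForm (braneCoeff Q fun s t => Real.exp (-q s t)))) ∧
    -- the numbers `b_s`
    IsUnit (e10.map (Int.cast : ℤ → ℝ)).det ∧
    (∀ s, (bNum s : ℝ) = 2 * ∑ s', (e10.map (Int.cast : ℤ → ℝ))⁻¹ s s') ∧
    (∑ s, bNum s = -2480) ∧
    -- the special one-block solution
    (∀ (J : Set ℝ), IsOpen J →
      ∀ (Q₀ C t₀ : ℝ), Q₀ ≠ 0 → (∀ t ∈ J, fbar Q₀ C t₀ t ≠ 0) →
      ∀ (Q : Fin 10 → ℝ), (∀ s, Q s ^ 2 = Q₀ ^ 2 * |(bNum s : ℝ)|) →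
        (∀ q : Fin 10 → ℝ → ℝ, q = (fun s t => -Real.log (fbar Q₀ C t₀ t ^ bNum s)) →
          (∀ s, ∀ t ∈ J, Real.exp (-q s t) = fbar Q₀ C t₀ t ^ bNum s) ∧
          IsTodaSolution Q J q ∧
          ∀ t ∈ J, todaEnergy Q q t = -620 * C) ∧
        (∀ s, s ≠ 10 → ∀ t ∈ J, braneCoeff Q (fun s t => fbar Q₀ C t₀ t ^ bNum s) s t =
          Q s * fbar Q₀ C t₀ t ^ (-2 : ℤ)) ∧
        ∀ (c cbar : Fin 16 → ℝ) (cphi cphibar : Fin 5 → ℝ),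
          LinearConstraints lam c cphi → LinearConstraints lam cbar cphibar →
          2 * (-620 * C) + constNorm c cphi = 0 →
          SolvesB16 lam (region J)
            (braneMetric (fun s t => fbar Q₀ C t₀ t ^ bNum s) c cbar)
            (braneScalar lam (fun s t => fbar Q₀ C t₀ t ^ bNum s) cphi cphibar)
            (braneForm (braneCoeff Q fun s t => fbar Q₀ C t₀ t ^ bNum s))) ∧
    -- the solution with one harmonic function `H = |Q| √2 (t - t₀)`
    (∀ (Q₀ t₀ : ℝ), Q₀ ≠ 0 →
      ∀ (Q : Fin 10 → ℝ), (∀ s, Q s ^ 2 = Q₀ ^ 2 * |(bNum s : ℝ)|) →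
      ∀ (ν : Fin 10 → ℝ), (∀ s, ∑ s', braneProd lam s s' * ν s' ^ 2 = -1) →
        (∀ s, SignType.sign (ν s) = -SignType.sign (Q s)) →
      ∀ (H : ℝ → ℝ), H = (fun t => |Q₀| * Real.sqrt 2 * (t - t₀)) →
        SolvesB16 lam (region (Ioi t₀)) (harmonicMetric ν H) (harmonicScalar lam ν H)
          (braneForm (harmonicCoeff ν H)) ∧
        ∀ x ∈ region (Ioi t₀),
          braneMetric (fun s t => fbar Q₀ 0 t₀ t ^ bNum s) 0 0 x = harmonicMetric ν H x ∧
          (∀ α, braneScalar lam (fun s t => fbar Q₀ 0 t₀ t ^ bNum s) 0 0 α x =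
            harmonicScalar lam ν H α x) ∧
          ∀ a, braneForm (braneCoeff Q fun s t => fbar Q₀ 0 t₀ t ^ bNum s) a x =
            braneForm (harmonicCoeff ν H) a x) := by
  have hprod := braneProd_eq_e10 hlam
  have hself : ∀ s, braneProd lam s s = 2 := fun s => by
    rw [hprod, e10_self]
    norm_num
  refine ⟨hself, fun s s' => ?_, fun s s' _ => card_inter_eq hlam s s', ?_, isUnit_det_e10, bNum_eq,
    sum_bNum, ?_, ?_⟩
  · rw [hself, hprod, mul_div_cancel_left₀ _ two_ne_zero]
  · intro J hJ hJ' Q _ q hq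
    refine ⟨fun t ht t' ht' => hq.todaEnergy_eq hJ hJ' ht ht', ?_⟩
    rintro c cbar cphi cphibar hc hcbar ⟨t₁, ht₁, hE⟩
    -- The constraint is given at a single time; conservation of the energy carries it to all of
    -- `J`.
    exact solvesB16_of_isTodaSolution hlam hJ hq hc hcbar fun t ht => by
      rw [hq.todaEnergy_eq hJ hJ' ht ht₁, hE]
  · intro J hJ Q₀ C t₀ _ hne Q hQ
    refine ⟨?_, fun s hs t ht => braneCoeff_oneBlock (hne t ht) hs,
      fun c cbar cphi cphibar hc hcbar hE => solvesB16_oneBlock hlam hJ hne hQ hc hcbar hE⟩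
    rintro q rfl
    exact ⟨fun s t ht => exp_neg_neg_log_zpow (hne t ht) s, isTodaSolution_oneBlock hJ hne hQ⟩
  · rintro Q₀ t₀ hQ₀ Q hQ ν hν hsign H rfl
    have hν2 := sq_of_braneProd hlam hν
    have hcharge : ∀ s, Q s = -(ν s * (|Q₀| * Real.sqrt 2)) := fun s =>
      charge_eq hQ₀ (by rw [hQ, abs_bNum]) (hν2 s) (hsign s)
    have hpos : ∀ t ∈ Ioi t₀, 0 < |Q₀| * Real.sqrt 2 * (t - t₀) := fun t ht => by
      have : 0 < t - t₀ := sub_pos.mpr ht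
      positivity
    have hne : ∀ t ∈ Ioi t₀, fbar Q₀ 0 t₀ t ≠ 0 := fun t ht => by
      rw [fbar_zero]
      exact (hpos t ht).ne'
    have h0 : LinearConstraints lam 0 0 := ⟨by simp, fun s => by
      rw [show Sum.elim (fun i : Fin 15 => (0 : Fin 16 → ℝ) i.succ) (0 : Fin 5 → ℝ) = 0 by
        funext A; cases A <;> rfl, dotProduct_zero]⟩
    -- With `C = 0` and all constants zero, the energy constraint is `0 = 0`.
    have hsol := solvesB16_oneBlock hlam isOpen_Ioi hne hQ h0 h0 (by simp [constNorm])
    rw [fbar_zero] at hsol ⊢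
    have hg := fun (x : Pt) (hx : x ∈ region (Ioi t₀)) =>
      braneMetric_harmonic hν2 (H := fun t => |Q₀| * Real.sqrt 2 * (t - t₀)) (x := x) (hpos _ hx)
    have hphi := fun (α : Fin 5) (x : Pt) =>
      braneScalar_harmonic (lam := lam) hν2 (fun t => |Q₀| * Real.sqrt 2 * (t - t₀)) α x
    have hF := fun (a : ℕ) (x : Pt) (hx : x ∈ region (Ioi t₀)) =>
      braneForm_congr (fun s => braneCoeff_harmonic hcharge (hpos _ hx).ne' s) a
    exact ⟨hsol.congr (isOpen_region isOpen_Ioi) (fun x hx => (hg x hx).symm)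
        (fun α x _ => (hphi α x).symm) (fun a x hx => (hF a x hx).symm),
      fun x hx => ⟨hg x hx, fun α => hphi α x, fun a => hF a x hx⟩⟩
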